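/- Let $(X_n)_{n\ge 0}$ be compact (boundaryless, smooth) Riemannian manifolds with their Riemannian distances $d$, and let $\mathcal F=(f_n)_{n\ge 0}$ be a sequence of $C^1$ surjective maps $f_n:X_n\to X_{n+1}$ which is expanding: there are $\delta_0>0$ and $\lambda_n\in(0,1)$ such that for all $n$, all $x\in X_{n+1}$ and all $x'\in f_n^{-1}(x)$ there is an inverse branch of $f_n$, defined on the ball $B(x,\delta_0)$, with values in an open neighbourhood of $x'$ which $f_n$ maps bijectively onto $B(x,\delta_0)$, and which is $\lambda_n$-Lipschitz. Assume $\sup_n\lambda_n<1$. For a sequence $\mathcal G=(g_n)_{n\ge0}$ of maps $g_n:X_n\to X_{n+1}$ write $G_n=g_{n-1}\circ\dots\circ g_0$ and $\mathcal G^{(n)}=(g_{n+k})_{k\ge 0}$ (and likewise $F_n$, $\mathcal F^{(n)}$). Write $|\|\mathcal F-\mathcal G\||=\sup_n d_{C^1}(f_n,g_n)$, where $d_{C^1}(f,g)=\sup_x\inf_\gamma\big(\mathrm{length}(\gamma)+\|P_\gamma\circ Df(x)-Dg(x)\|\big)$, the infimum being over $C^1$ curves $\gamma$ from $f(x)$ to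 $g(x)$ and $P_\gamma$ denoting the Levi-Civita parallel transport along $\gamma$. For $\eta>0$, say that a homeomorphism $h:X_0\to X_0$ is $\eta$-conjugating for $(\mathcal F,\mathcal G)$ if there are homeomorphisms $h_k:X_k\to X_k$, $k\ge 0$, with $h_0=h$, $h_k\circ G_k=F_k\circ h_0$ and $\sup_{x} d(h_k(x),x)\le\eta$ for all $k$ (and similarly for the pairs of shifted sequences, starting from $X_n$). Then there are $\varepsilon,\eta,L>0$, depending only on $\mathcal F$, such that for every sequence $\mathcal G$ of $C^1$ maps with $|\|\mathcal F-\mathcal G\||<\varepsilon$ there are homeomorphisms $h_{\mathcal F^{(n)},\mathcal G^{(n)}}$ and $h_{\mathcal G^{(n)},\mathcal F^{(n)}}=h_{\mathcal F^{(n)},\mathcal G^{(n)}}^{-1}$ of $X_n$, $n\ge0$, which are $\eta$-conjugating for $(\mathcal F^{(n)},\mathcal G^{(n)})$ and for $(\mathcal G^{(n)},\mathcal F^{(n)})$ respectively, and which satisfy, for all $n\ge 0$, $$h_{\mathcal G^{(n)},\mathcal F^{(n)}}\circ F_n=G_n\circ h_{\mathcal G,\mathcal F},\qquad h_{\mathcal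 F^{(n)},\mathcal G^{(n)}}\circ G_n=F_n\circ h_{\mathcal F,\mathcal G}.$$ Moreover $\|h_{\mathcal F,\mathcal G}-\mathrm{id}\|_{C^0}\le L\,|\|\mathcal G-\mathcal F\||$, and likewise $\|h_{\mathcal F^{(n)},\mathcal G^{(n)}}-\mathrm{id}\|_{C^0}\le L\,|\|\mathcal G^{(n)}-\mathcal F^{(n)}\||$ for all $n$. If in addition there is $\rho>0$ such that $f_n(x)\ne f_n(y)$ for all $n$ and all $x,y\in X_n$ with $0<d(x,y)<\rho$ (for instance if $\sup_n\sup_x\|Df_n(x)\|<\infty$), then these homeomorphisms are unique: for every $n$, $h_{\mathcal F^{(n)},\mathcal G^{(n)}}$ is the only $\eta$-conjugating homeomorphism for $(\mathcal F^{(n)},\mathcal G^{(n)})$, and $h_{\mathcal G^{(n)},\mathcal F^{(n)}}$ is the only one for $(\mathcal G^{(n)},\mathcal F^{(n)})$. -/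

import Mathlib

open Bundle
open scoped Manifold ContDiff ENNReal Bundle

noncomputable section

namespace SeqDyn

section Riemannian

variable {E : Type*} [NormedAddCommGroup E] [NormedSpace ℝ E] [FiniteDimensional ℝ E]
  {M : Type*} [MetricSpace M] [ChartedSpace E M] [IsManifold 𝓘(ℝ, E) ∞ M]
  [RiemannianBundle (fun x : M ↦ TangentSpace 𝓘(ℝ, E) x)]
  [IsContMDiffRiemannianBundle 𝓘(ℝ, E) ∞ E (fun x : M ↦ TangentSpace 𝓘(ℝ, E) x)]

/-- The Levi-Civita connection: torsion free, and metric, i.e.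
`v ⟨Y, Z⟩ = ⟨∇_v Y, Z⟩ + ⟨Y, ∇_v Z⟩` for vector fields `Y`, `Z` differentiable at `x` and
`v ∈ T_x M`. -/
def IsLeviCivita
    (cov : CovariantDerivative 𝓘(ℝ, E) E (fun x : M ↦ TangentSpace 𝓘(ℝ, E) x)) : Prop :=
  cov.torsion = 0 ∧
  ∀ (Y Z : (x : M) → TangentSpace 𝓘(ℝ, E) x) (x : M),
    MDifferentiableAt 𝓘(ℝ, E) 𝓘(ℝ, E).tangent
      (fun y ↦ (⟨y, Y y⟩ : TangentBundle 𝓘(ℝ, E) M)) x →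
    MDifferentiableAt 𝓘(ℝ, E) 𝓘(ℝ, E).tangent
      (fun y ↦ (⟨y, Z y⟩ : TangentBundle 𝓘(ℝ, E) M)) x →
    ∀ v : TangentSpace 𝓘(ℝ, E) x,
      mfderiv 𝓘(ℝ, E) 𝓘(ℝ, ℝ) (fun y ↦ inner ℝ (Y y) (Z y)) x v =
        (inner ℝ (cov Y x v) (Z x) + inner ℝ (Y x) (cov Z x v) : ℝ)

/-- `V` is a parallel vector field along the curve `γ : [0, 1] → M`: it lies over `γ`, and its
covariant derivative along `γ` for the Levi-Civita connection vanishes. As the connection is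
metric, this is tested against all smooth vector fields `Z` on `M`:
`d/ds ⟨V, Z ∘ γ⟩ = ⟨V, ∇_{γ'} Z⟩`. -/
def IsParallelAlong (γ : ℝ → M) (V : ℝ → TangentBundle 𝓘(ℝ, E) M) : Prop :=
  (∀ t ∈ Set.Icc (0 : ℝ) 1, (V t).proj = γ t) ∧
  ∃ cov : CovariantDerivative 𝓘(ℝ, E) E (fun x : M ↦ TangentSpace 𝓘(ℝ, E) x),
    IsLeviCivita cov ∧
    ∀ Z : (x : M) → TangentSpace 𝓘(ℝ, E) x,
      ContMDiff 𝓘(ℝ, E) 𝓘(ℝ, E).tangent ∞ (fun x ↦ (⟨x, Z x⟩ : TangentBundle 𝓘(ℝ, E) M)) →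
      ∀ t ∈ Set.Icc (0 : ℝ) 1,
        HasDerivWithinAt (fun s ↦ inner ℝ (V s).snd (Z (V s).proj))
          (inner ℝ (V t).snd (cov Z (V t).proj
            (mfderivWithin 𝓘(ℝ, ℝ) 𝓘(ℝ, E) (fun s ↦ (V s).proj) (Set.Icc 0 1) t (1 : ℝ))))
          (Set.Icc 0 1) t

/-- `γ` is a `C^1` curve from `p` to `q` and the linear isometry `P` is the parallel transport
along `γ`. -/
def IsParallelTransport (γ : ℝ → M) {p q : M}
    (P : TangentSpace 𝓘(ℝ, E) p ≃ₗᵢ[ℝ] TangentSpace 𝓘(ℝ, E) q) : Prop :=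
  γ 0 = p ∧ γ 1 = q ∧ ContMDiffOn 𝓘(ℝ, ℝ) 𝓘(ℝ, E) 1 γ (Set.Icc 0 1) ∧
  ∀ v : TangentSpace 𝓘(ℝ, E) p, ∃ V : ℝ → TangentBundle 𝓘(ℝ, E) M,
    IsParallelAlong γ V ∧ V 0 = ⟨p, v⟩ ∧ V 1 = ⟨q, P v⟩

end Riemannian

section C1

variable {E : Type*} [NormedAddCommGroup E] [NormedSpace ℝ E] [FiniteDimensional ℝ E]
  {M : Type*} [MetricSpace M] [ChartedSpace E M] [IsManifold 𝓘(ℝ, E) ∞ M]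
  [RiemannianBundle (fun x : M ↦ TangentSpace 𝓘(ℝ, E) x)]
  [IsContMDiffRiemannianBundle 𝓘(ℝ, E) ∞ E (fun x : M ↦ TangentSpace 𝓘(ℝ, E) x)]
  {E' : Type*} [NormedAddCommGroup E'] [NormedSpace ℝ E'] [FiniteDimensional ℝ E']
  {M' : Type*} [MetricSpace M'] [ChartedSpace E' M'] [IsManifold 𝓘(ℝ, E') ∞ M']
  [RiemannianBundle (fun x : M' ↦ TangentSpace 𝓘(ℝ, E') x)]
  [IsContMDiffRiemannianBundle 𝓘(ℝ, E') ∞ E' (fun x : M' ↦ TangentSpace 𝓘(ℝ, E') x)]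

/-- The `C^1` distance of two `C^1` maps between Riemannian manifolds: the supremum over `x` of
`length γ + ‖P_γ ∘ Df(x) - Dg(x)‖` (operator norm, written as a supremum over the unit ball), minimized over the `C^1` curves `γ` from
`f x` to `g x`, where `P_γ` is the parallel transport along `γ`. -/
def c1EDist (f g : M → M') : ℝ≥0∞ :=
  ⨆ x : M, ⨅ (γ : ℝ → M')
    (P : TangentSpace 𝓘(ℝ, E') (f x) ≃ₗᵢ[ℝ] TangentSpace 𝓘(ℝ, E') (g x))
    (_ : IsParallelTransport γ P),
    Manifold.pathELength 𝓘(ℝ, E') γ 0 1 +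
      ⨆ (v : TangentSpace 𝓘(ℝ, E) x) (_ : ‖v‖ ≤ 1),
        ‖P (mfderiv 𝓘(ℝ, E) 𝓘(ℝ, E') f x v) - mfderiv 𝓘(ℝ, E) 𝓘(ℝ, E') g x v‖ₑ

end C1

section C1Seq

variable {E : ℕ → Type*} [∀ n, NormedAddCommGroup (E n)] [∀ n, NormedSpace ℝ (E n)]
  [∀ n, FiniteDimensional ℝ (E n)]
  {X : ℕ → Type*} [∀ n, MetricSpace (X n)] [∀ n, ChartedSpace (E n) (X n)]
  [∀ n, IsManifold 𝓘(ℝ, E n) ∞ (X n)]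
  [∀ n, RiemannianBundle (fun x : X n ↦ TangentSpace 𝓘(ℝ, E n) x)]
  [∀ n, IsContMDiffRiemannianBundle 𝓘(ℝ, E n) ∞ (E n)
    (fun x : X n ↦ TangentSpace 𝓘(ℝ, E n) x)]

/-- `|‖F - G‖| = sup_n d_{C^1}(f_n, g_n)`. -/
def seqC1EDist (f g : (n : ℕ) → X n → X (n + 1)) : ℝ≥0∞ :=
  ⨆ n : ℕ, c1EDist (E := E n) (E' := E (n + 1)) (f n) (g n)

end C1Seq

section Sequences

variable {X : ℕ → Type*}

/-- `F_n = f_{n-1} ∘ ⋯ ∘ f_1 ∘ f_0`. -/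
def orbitMap (f : (n : ℕ) → X n → X (n + 1)) : (n : ℕ) → X 0 → X n
  | 0 => id
  | n + 1 => f n ∘ orbitMap f n

/-- The shifted sequence `F^{(m)} = (f_{m+k})_k`, acting on the spaces `X_{m+k}`. -/
def shift (f : (n : ℕ) → X n → X (n + 1)) (m : ℕ) (k : ℕ) : X (m + k) → X (m + (k + 1)) :=
  f (m + k)

variable [∀ n, MetricSpace (X n)]

/-- A sequence of expanding maps with rates `lam n`: the maps are continuous and onto, and there is
`δ₀ > 0` such that at each `x' ∈ f_n⁻¹(x)` there is an inverse branch `φ` of `f_n` from the ball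
`B(x, δ₀)` to an open neighbourhood `V` of `x'` which contracts distances by the factor
`lam n`. -/
def IsExpandingSeq (f : (n : ℕ) → X n → X (n + 1)) (lam : ℕ → ℝ) : Prop :=
  (∀ n, Continuous (f n)) ∧ (∀ n, Function.Surjective (f n)) ∧
  (∀ n, 0 < lam n ∧ lam n < 1) ∧
  ∃ δ₀ : ℝ, 0 < δ₀ ∧ ∀ (n : ℕ) (x : X (n + 1)) (x' : X n), f n x' = x →
    ∃ (V : Set (X n)) (φ : X (n + 1) → X n),
      IsOpen V ∧ x' ∈ V ∧ Set.BijOn (f n) V (Metric.ball x δ₀) ∧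
      Set.InvOn φ (f n) V (Metric.ball x δ₀) ∧
      ∀ y ∈ Metric.ball x δ₀, ∀ z ∈ Metric.ball x δ₀, dist (φ y) (φ z) ≤ lam n * dist y z

/-- The maps `f_n` are injective on all balls of some common size. -/
def IsUniformlyLocallyInjective (f : (n : ℕ) → X n → X (n + 1)) : Prop :=
  ∃ ρ : ℝ, 0 < ρ ∧ ∀ (n : ℕ) (x y : X n), dist x y < ρ → f n x = f n y → x = y

/-- `H` is a sequential conjugacy between `F` and `G`: `H_n ∘ F_n = G_n ∘ H_0` for all `n`. -/
def IsSequentialConjugacy (f g : (n : ℕ) → X n → X (n + 1)) (H : (n : ℕ) → X n ≃ₜ X n) : Prop :=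
  ∀ n, H n ∘ orbitMap f n = orbitMap g n ∘ H 0

/-- `h` has the property that singles out `h_{F,G}`: it is the first term of a sequential
conjugacy between `G` and `F` all of whose terms are `η`-close to the identity. -/
def IsConjugatingHomeo (η : ℝ) (f g : (n : ℕ) → X n → X (n + 1)) (h : X 0 ≃ₜ X 0) : Prop :=
  ∃ H : (n : ℕ) → X n ≃ₜ X n, H 0 = h ∧ IsSequentialConjugacy g f H ∧
    ∀ (n : ℕ) (x : X n), dist (H n x) x ≤ η

end Sequences

end SeqDyn

end

/-!
The theorem is the structural stability of uniformly expanding sequences of maps. Parallel transport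
enters only through being isometric: `C^1`-closeness of `f` and `g` gives that `f n` and `g n` are
uniformly close (`edist_le_c1EDist`) and that their derivatives have nearly the same norm on each
tangent vector (`norm_mfderiv_le_of_c1EDist_lt`).

*Conjugacy.* Suppose that `f` and `g` have inverse branches over balls of a uniform radius which
contract by a uniform factor `μ < 1` (`InverseBranches`). If `φ_x` denotes the branch of `f n` at
`x`, the equations `H n x = φ_x (H (n + 1) (g n x))` have a continuous solution close to the
identity, obtained by iteration from the identity (`exists_fixed_point`), and any solution satisfies
`f n ∘ H n = H (n + 1) ∘ g n`. Exchanging the roles of `f` and `g` gives maps `K n`. Balls of a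
Riemannian manifold are connected, so that branches at nearby points agree; hence the displacement
of `K n ∘ H n` contracts along `g`, and `K n` is the inverse of `H n` (`leftInverse_fixed_points`).
The linear bound on the displacement comes from the same contraction. When `f` is injective at a
uniform scale, orbits of `f` which remain close coincide (`eq_of_dist_orbitMap_le`), and this gives
uniqueness, for `(g, f)` too since `H` carries orbits of `g` to orbits of `f`.

*Branches of the perturbation.* The manifolds `X n` need not have uniformly bounded geometry, so
the scale of the branches of `g` does not come from an inverse function theorem with uniform
constants. The derivative of `f n` expands norms at least by the inverse of the Lipschitz constant
of the branches (`norm_le_mul_norm_mfderiv`), and it is bijective, the dimensions being equal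
because an image under a `C^1` map of a lower dimensional space contains no ball
(`finrank_le_of_section`).
So the derivative of `g n` is expanding and bijective, `g n` is a local homeomorphism, and a
covering map by compactness. A small ball of `X (n + 1)` is mapped into a convex chart domain of the
compact manifold `X 0` by composing branches of `f`; the map `F_{n+1}` from this simply connected
domain lifts through `g n`, and the composition is a section of `g n` over the ball, whose radius
depends on `f` and `X 0` only (`exists_scale_section`). Integrating along paths, it
contracts distances (`dist_section_le`).
-/

noncomputable section

namespace SeqDyn

/-! ### Sequences of maps with uniform contracting inverse branches -/

section Metric

variable {X : ℕ → Type*}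

lemma comp_orbitMap {f g : (n : ℕ) → X n → X (n + 1)} {H : (n : ℕ) → X n → X n}
    (hH : ∀ n x, f n (H n x) = H (n + 1) (g n x)) (n : ℕ) :
    H n ∘ orbitMap g n = orbitMap f n ∘ H 0 := by
  induction n with
  | zero => rfl
  | succ n ih =>
    funext x
    have := congrFun ih x
    simp only [Function.comp_apply, orbitMap] at this ⊢
    rw [← hH, this]

/-- If a family of functions, bounded by `D`, contracts along `g` up to an error `c`,
then it is bounded by the fixed point `c / (1 - μ)` of `t ↦ μ * t + c`. -/
lemma le_div_of_le_mul_add {μ c D : ℝ} (hμ : 0 ≤ μ) (hμ1 : μ < 1)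
    {g : (n : ℕ) → X n → X (n + 1)} {d : (n : ℕ) → X n → ℝ} (hd : ∀ n x, d n x ≤ D) {N : ℕ}
    (hstep : ∀ n ≥ N, ∀ x, d n x ≤ μ * d (n + 1) (g n x) + c) {n : ℕ} (hn : N ≤ n) (x : X n) :
    d n x ≤ c / (1 - μ) := by
  have key : ∀ j : ℕ, ∀ n ≥ N, ∀ x : X n, d n x ≤ c / (1 - μ) + μ ^ j * (D - c / (1 - μ)) := by
    intro j
    induction j with
    | zero => intro n _ x; simpa using hd n x
    | succ j ih =>
      intro n hn x
      have h1 := hstep n hn x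
      have h2 := mul_le_mul_of_nonneg_left (ih (n + 1) (by omega) (g n x)) hμ
      have h3 : μ * (c / (1 - μ)) + c = c / (1 - μ) := by
        have : (1 - μ) ≠ 0 := by linarith
        field_simp
        ring
      calc d n x ≤ μ * (c / (1 - μ) + μ ^ j * (D - c / (1 - μ))) + c := by linarith
        _ = (μ * (c / (1 - μ)) + c) + μ ^ (j + 1) * (D - c / (1 - μ)) := by ring
        _ = _ := by rw [h3]
  have hlim : Filter.Tendsto (fun j : ℕ ↦ c / (1 - μ) + μ ^ j * (D - c / (1 - μ)))
      Filter.atTop (nhds (c / (1 - μ))) := by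
    simpa using ((tendsto_pow_atTop_nhds_zero_of_lt_one hμ hμ1).mul_const
      (D - c / (1 - μ))).const_add (c / (1 - μ))
  exact ge_of_tendsto' hlim fun j ↦ key j n hn x

variable [∀ n, MetricSpace (X n)]

/-- A choice of inverse branches for a sequence of continuous, locally injective maps: `branch n x`
is a `μ`-Lipschitz section of `f n` over the ball of radius `r` around `f n x` which sends
`f n x` to `x`. Outside that ball its values are unconstrained. -/
structure InverseBranches (f : (n : ℕ) → X n → X (n + 1)) (r μ : ℝ) where
  continuous : ∀ n, Continuous (f n)
  locallyInjective : ∀ n, IsLocallyInjective (f n)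
  branch : ∀ n, X n → X (n + 1) → X n
  branch_self : ∀ n x, branch n x (f n x) = x
  map_branch : ∀ n x, ∀ y ∈ Metric.ball (f n x) r, f n (branch n x y) = y
  dist_branch_le : ∀ n x, ∀ y ∈ Metric.ball (f n x) r, ∀ z ∈ Metric.ball (f n x) r,
    dist (branch n x y) (branch n x z) ≤ μ * dist y z

namespace InverseBranches

variable {f g : (n : ℕ) → X n → X (n + 1)} {r μ : ℝ}

lemma dist_branch_self_le (B : InverseBranches f r μ) {n : ℕ} {x : X n} {y : X (n + 1)}
    (hy : y ∈ Metric.ball (f n x) r) : dist (B.branch n x y) x ≤ μ * dist y (f n x) := by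
  have h := B.dist_branch_le n x y hy (f n x)
    (Metric.mem_ball_self (dist_nonneg.trans_lt (Metric.mem_ball.1 hy)))
  rwa [B.branch_self] at h

lemma continuousOn_branch (B : InverseBranches f r μ) (n : ℕ) (x : X n) :
    ContinuousOn (B.branch n x) (Metric.ball (f n x) r) :=
  (LipschitzOnWith.of_dist_le_mul (K := μ.toNNReal) fun y hy z hz ↦
    (B.dist_branch_le n x y hy z hz).trans
      (mul_le_mul_of_nonneg_right (Real.le_coe_toNNReal μ) dist_nonneg)).continuousOn

/-- Two lifts through `f n` over a preconnected set coincide as soon as they agree at a point. -/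
lemma eqOn_of_isPreconnected (B : InverseBranches f r μ) {n : ℕ} {Y : Type*} [TopologicalSpace Y]
    {S : Set Y} (hS : IsPreconnected S) {φ ψ : Y → X n} (hφ : ContinuousOn φ S)
    (hψ : ContinuousOn ψ S) (h : S.EqOn (f n ∘ φ) (f n ∘ ψ)) {p : Y} (hp : p ∈ S)
    (hpp : φ p = ψ p) : S.EqOn φ ψ :=
  (T2Space.isSeparatedMap (f n)).eqOn_of_comp_eqOn (B.locallyInjective n) hS hφ hψ h hp hpp

/-- The branch at a point `x'` in the range of the branch at `x` is the branch at `x`. -/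
lemma branch_eq_branch
    (hball : ∀ (n : ℕ) (x : X n) (s : ℝ), IsPreconnected (Metric.ball x s))
    (B : InverseBranches f r μ) {n : ℕ} {x x' : X n}
    (hx' : B.branch n x (f n x') = x') (hd : dist (f n x') (f n x) < r / 2) {w : X (n + 1)}
    (hw : dist w (f n x') < r / 2) : B.branch n x' w = B.branch n x w := by
  have hsub : Metric.ball (f n x') (r / 2) ⊆ Metric.ball (f n x) r := fun y hy ↦ by
    rw [Metric.mem_ball] at hy ⊢
    linarith [dist_triangle y (f n x') (f n x)]
  have hr : 0 < r / 2 := dist_nonneg.trans_lt hd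
  have hsub' : Metric.ball (f n x') (r / 2) ⊆ Metric.ball (f n x') r :=
    Metric.ball_subset_ball (by linarith)
  refine B.eqOn_of_isPreconnected (hball (n + 1) (f n x') (r / 2))
    ((B.continuousOn_branch n x').mono hsub') ((B.continuousOn_branch n x).mono hsub)
    (fun y hy ↦ ?_) (Metric.mem_ball_self hr) ?_ (Metric.mem_ball.2 hw)
  · simp only [Function.comp_apply]
    rw [B.map_branch n x' y (hsub' hy), B.map_branch n x y (hsub hy)]
  · rw [B.branch_self, hx']

/-- Points close to `x` lie on the branch at `x`. -/
lemma eventually_branch_self (B : InverseBranches f r μ) (hr : 0 < r) {n : ℕ} (x₀ : X n) :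
    ∀ᶠ x in nhds x₀, B.branch n x₀ (f n x) = x := by
  have hc : ContinuousAt (B.branch n x₀) (f n x₀) :=
    (B.continuousOn_branch n x₀).continuousAt (Metric.ball_mem_nhds _ hr)
  have hfc : ContinuousAt (f n) x₀ := (B.continuous n).continuousAt
  obtain ⟨U, hUo, hxU, hinj⟩ := B.locallyInjective n x₀
  have h1 : ∀ᶠ x in nhds x₀, B.branch n x₀ (f n x) ∈ U :=
    (ContinuousAt.comp (f := f n) (g := B.branch n x₀) hc hfc).eventually
      (by rw [Function.comp_apply, B.branch_self]; exact hUo.mem_nhds hxU)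
  have h2 : ∀ᶠ x in nhds x₀, f n x ∈ Metric.ball (f n x₀) r :=
    hfc.eventually (Metric.ball_mem_nhds _ hr)
  filter_upwards [h1, h2, hUo.mem_nhds hxU] with x hx1 hx2 hx3
  exact hinj hx1 hx3 (B.map_branch n x₀ _ hx2)

/-- Nearby base points have the same branch, so that the branch at `x` may be followed
continuously in `x`. -/
lemma continuous_branch_comp
    (hball : ∀ (n : ℕ) (x : X n) (s : ℝ), IsPreconnected (Metric.ball x s))
    (B : InverseBranches f r μ) {n : ℕ} {u : X n → X (n + 1)}
    (hu : Continuous u) (hr : 0 < r) (hd : ∀ x, dist (u x) (f n x) < r / 2) :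
    Continuous fun x ↦ B.branch n x (u x) := by
  refine continuous_iff_continuousAt.2 fun x₀ ↦ ?_
  have hfc : ContinuousAt (f n) x₀ := (B.continuous n).continuousAt
  have h2 : ∀ᶠ x in nhds x₀, f n x ∈ Metric.ball (f n x₀) (r / 2) :=
    hfc.eventually (Metric.ball_mem_nhds _ (half_pos hr))
  have key : ∀ᶠ x in nhds x₀, B.branch n x₀ (u x) = B.branch n x (u x) := by
    filter_upwards [B.eventually_branch_self hr x₀, h2] with x hx1 hx2
    exact (B.branch_eq_branch hball hx1 (Metric.mem_ball.1 hx2) (hd x)).symm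
  refine ContinuousAt.congr ?_ key
  have hux : u x₀ ∈ Metric.ball (f n x₀) r := by
    rw [Metric.mem_ball]; linarith [hd x₀]
  exact ContinuousAt.comp (g := B.branch n x₀)
    ((B.continuousOn_branch n x₀).continuousAt (Metric.isOpen_ball.mem_nhds hux)) hu.continuousAt

/-- The iterates of the graph transform `H ↦ (x ↦ φ_x (H (g x)))`, started at the identity, where
`φ_x` is the branch of `f n` at `x`. -/
def approx (B : InverseBranches f r μ) (g : (n : ℕ) → X n → X (n + 1)) :
    ℕ → (n : ℕ) → X n → X n
  | 0, _ => id
  | m + 1, n => fun x ↦ B.branch n x (approx B g m (n + 1) (g n x))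

lemma dist_approx_le (B : InverseBranches f r μ) {a D : ℝ} (hμ : 0 ≤ μ) (hD0 : 0 ≤ D)
    (hfg : ∀ n x, dist (f n x) (g n x) ≤ a) (hD : μ * (D + a) ≤ D) (hr : D + a < r) (m : ℕ) :
    ∀ (n : ℕ) (x : X n), dist (B.approx g m n x) x ≤ D := by
  induction m with
  | zero => intro n x; simpa [approx] using hD0
  | succ m ih =>
    intro n x
    have h1 : dist (B.approx g m (n + 1) (g n x)) (f n x) ≤ D + a := by
      linarith [dist_triangle (B.approx g m (n + 1) (g n x)) (g n x) (f n x),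
        ih (n + 1) (g n x), hfg n x, dist_comm (f n x) (g n x)]
    exact (B.dist_branch_self_le (Metric.mem_ball.2 (h1.trans_lt hr))).trans
      ((mul_le_mul_of_nonneg_left h1 hμ).trans hD)

lemma dist_approx_succ_le (B : InverseBranches f r μ) {a D : ℝ} (hμ : 0 ≤ μ) (hD0 : 0 ≤ D)
    (hfg : ∀ n x, dist (f n x) (g n x) ≤ a) (hD : μ * (D + a) ≤ D) (hr : D + a < r) (m : ℕ) :
    ∀ (n : ℕ) (x : X n), dist (B.approx g m n x) (B.approx g (m + 1) n x) ≤ D * μ ^ m := by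
  have hmem : ∀ (m n : ℕ) (x : X n),
      B.approx g m (n + 1) (g n x) ∈ Metric.ball (f n x) r := fun m n x ↦ by
    rw [Metric.mem_ball]
    linarith [dist_triangle (B.approx g m (n + 1) (g n x)) (g n x) (f n x),
      B.dist_approx_le hμ hD0 hfg hD hr m (n + 1) (g n x), hfg n x, dist_comm (f n x) (g n x)]
  induction m with
  | zero =>
    intro n x
    have := B.dist_approx_le hμ hD0 hfg hD hr 1 n x
    rw [dist_comm]
    simpa [approx] using this
  | succ m ih =>
    intro n x
    refine (B.dist_branch_le n x _ (hmem m n x) _ (hmem (m + 1) n x)).trans ?_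
    calc μ * _ ≤ μ * (D * μ ^ m) := mul_le_mul_of_nonneg_left (ih (n + 1) (g n x)) hμ
      _ = D * μ ^ (m + 1) := by ring

/-- The graph transform has a continuous fixed point close to the identity. -/
lemma exists_fixed_point [∀ n, CompleteSpace (X n)]
    (hball : ∀ (n : ℕ) (x : X n) (s : ℝ), IsPreconnected (Metric.ball x s))
    (B : InverseBranches f r μ) (hg : ∀ n, Continuous (g n)) {a D : ℝ} (hμ : 0 ≤ μ) (hμ1 : μ < 1)
    (hD0 : 0 ≤ D) (ha : 0 ≤ a) (hfg : ∀ n x, dist (f n x) (g n x) ≤ a) (hD : μ * (D + a) ≤ D)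
    (hr : D + a < r / 2) :
    ∃ H : (n : ℕ) → X n → X n, (∀ n, Continuous (H n)) ∧ (∀ n x, dist (H n x) x ≤ D) ∧
      ∀ n x, H n x = B.branch n x (H (n + 1) (g n x)) := by
  have hr0 : 0 < r := by linarith
  have hr' : D + a < r := by linarith
  have hstep := B.dist_approx_succ_le hμ hD0 hfg hD hr'
  have hcau : ∀ n x, CauchySeq fun m ↦ B.approx g m n x := fun n x ↦
    cauchySeq_of_le_geometric μ D hμ1 fun m ↦ hstep m n x
  choose H hH using fun n x ↦ cauchySeq_tendsto_of_complete (hcau n x)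
  have hHD : ∀ n x, dist (H n x) x ≤ D := fun n x ↦
    le_of_tendsto ((hH n x).dist tendsto_const_nhds)
      (Filter.Eventually.of_forall fun m ↦ B.dist_approx_le hμ hD0 hfg hD hr' m n x)
  have hclose : ∀ n (x : X n) {p : X (n + 1)}, dist p (g n x) ≤ D → dist p (f n x) < r / 2 :=
    fun n x p hp ↦ by
      linarith [dist_triangle p (g n x) (f n x), hfg n x, dist_comm (f n x) (g n x)]
  refine ⟨H, fun n ↦ ?_, hHD, fun n x ↦ ?_⟩
  · have hcont : ∀ m n, Continuous (B.approx g m n) := by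
      intro m
      induction m with
      | zero => exact fun n ↦ continuous_id
      | succ m ih =>
        exact fun n ↦ B.continuous_branch_comp hball ((ih (n + 1)).comp (hg n)) hr0 fun x ↦
          hclose n x (B.dist_approx_le hμ hD0 hfg hD hr' m (n + 1) (g n x))
    have hunif : TendstoUniformly (fun m ↦ B.approx g m n) (H n) Filter.atTop := by
      rw [Metric.tendstoUniformly_iff]
      intro e he
      have hlim : Filter.Tendsto (fun m : ℕ ↦ D * μ ^ m / (1 - μ)) Filter.atTop (nhds 0) := by
        simpa using ((tendsto_pow_atTop_nhds_zero_of_lt_one hμ hμ1).const_mul D).div_const (1 - μ)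
      filter_upwards [hlim.eventually (gt_mem_nhds he)] with m hm x
      rw [dist_comm]
      exact (dist_le_of_le_geometric_of_tendsto μ D hμ1 (fun m ↦ hstep m n x) (hH n x) m).trans_lt
        hm
    exact hunif.continuous (Filter.Frequently.of_forall fun m ↦ hcont m n)
  · have hmem : H (n + 1) (g n x) ∈ Metric.ball (f n x) r := by
      rw [Metric.mem_ball]; linarith [hclose n x (hHD (n + 1) (g n x))]
    have h1 : Filter.Tendsto (fun m ↦ B.approx g (m + 1) n x) Filter.atTop
        (nhds (B.branch n x (H (n + 1) (g n x)))) :=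
      ((B.continuousOn_branch n x).continuousAt (Metric.isOpen_ball.mem_nhds hmem)).tendsto.comp
        (hH (n + 1) (g n x))
    exact tendsto_nhds_unique ((Filter.tendsto_add_atTop_iff_nat 1).2 (hH n x)) h1

lemma semiconj_of_fixed_point (B : InverseBranches f r μ) {a D : ℝ}
    (hfg : ∀ n x, dist (f n x) (g n x) ≤ a) (hr : D + a < r) {H : (n : ℕ) → X n → X n}
    (hHD : ∀ n x, dist (H n x) x ≤ D) (hH : ∀ n x, H n x = B.branch n x (H (n + 1) (g n x)))
    (n : ℕ) (x : X n) : f n (H n x) = H (n + 1) (g n x) := by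
  rw [hH n x]
  refine B.map_branch n x _ (Metric.mem_ball.2 ?_)
  linarith [dist_triangle (H (n + 1) (g n x)) (g n x) (f n x), hfg n x,
    dist_comm (f n x) (g n x), hHD (n + 1) (g n x)]

/-- The displacement of the fixed point at time `N` is controlled by the distances of the maps
from time `N` on. -/
lemma dist_fixed_point_le (B : InverseBranches f r μ) {a D : ℝ} (hμ : 0 ≤ μ) (hμ1 : μ < 1)
    (hfg : ∀ n x, dist (f n x) (g n x) ≤ a) (hr : D + a < r) {H : (n : ℕ) → X n → X n}
    (hHD : ∀ n x, dist (H n x) x ≤ D) (hH : ∀ n x, H n x = B.branch n x (H (n + 1) (g n x)))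
    {N : ℕ} {b : ℝ} (hb : ∀ n ≥ N, ∀ x, dist (f n x) (g n x) ≤ b) (x : X N) :
    dist (H N x) x ≤ μ / (1 - μ) * b := by
  rw [div_mul_eq_mul_div]
  refine le_div_of_le_mul_add (g := g) (d := fun n x ↦ dist (H n x) x) hμ hμ1 hHD
    (fun n hn x ↦ ?_) le_rfl x
  have htri := dist_triangle (H (n + 1) (g n x)) (g n x) (f n x)
  have hc := dist_comm (f n x) (g n x)
  have hmem : H (n + 1) (g n x) ∈ Metric.ball (f n x) r := by
    rw [Metric.mem_ball]
    linarith [hfg n x, hHD (n + 1) (g n x)]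
  calc dist (H n x) x = dist (B.branch n x (H (n + 1) (g n x))) x := by rw [← hH]
    _ ≤ μ * dist (H (n + 1) (g n x)) (f n x) := B.dist_branch_self_le hmem
    _ ≤ μ * (dist (H (n + 1) (g n x)) (g n x) + b) :=
        mul_le_mul_of_nonneg_left (by linarith [hb n hn x]) hμ
    _ = _ := by ring

/-- The fixed points of the graph transforms of `(f, g)` and of `(g, f)` are mutually inverse:
`T n = K n ∘ H n` satisfies `T n x = ψ_x (T (n + 1) (g n x))` for the branches `ψ_x` of `g`, so that
its displacement contracts. -/
lemma leftInverse_fixed_points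
    (hball : ∀ (n : ℕ) (x : X n) (s : ℝ), IsPreconnected (Metric.ball x s))
    (B : InverseBranches f r μ) (C : InverseBranches g r μ) {a D : ℝ} (hμ : 0 ≤ μ) (hμ1 : μ < 1)
    (hD0 : 0 ≤ D) (ha : 0 ≤ a) (hfg : ∀ n x, dist (f n x) (g n x) ≤ a) (hr : 6 * (D + a) < r)
    {H K : (n : ℕ) → X n → X n}
    (hHD : ∀ n x, dist (H n x) x ≤ D) (hH : ∀ n x, H n x = B.branch n x (H (n + 1) (g n x)))
    (hKD : ∀ n x, dist (K n x) x ≤ D) (hK : ∀ n x, K n x = C.branch n x (K (n + 1) (f n x)))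
    (n : ℕ) (x : X n) : K n (H n x) = x := by
  have hT : ∀ n x, dist (K n (H n x)) x ≤ 2 * D := fun n x ↦ by
    linarith [dist_triangle (K n (H n x)) (H n x) x, hKD n (H n x), hHD n x]
  have hstep : ∀ n x, K n (H n x) = C.branch n x (K (n + 1) (H (n + 1) (g n x))) := by
    intro n x
    have hfx : dist (H (n + 1) (g n x)) (f n x) ≤ D + a := by
      linarith [dist_triangle (H (n + 1) (g n x)) (g n x) (f n x), hfg n x,
        dist_comm (f n x) (g n x), hHD (n + 1) (g n x)]
    -- The point `H n x` lies on the branch of `g n` at `x`: follow the branch of `f n` at `x`.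
    have hsub : Metric.ball (f n x) (r - 2 * a) ⊆ Metric.ball (f n x) r :=
      Metric.ball_subset_ball (by linarith)
    have hgc : ContinuousOn (fun y ↦ g n (B.branch n x y)) (Metric.ball (f n x) (r - 2 * a)) :=
      (C.continuous n).comp_continuousOn ((B.continuousOn_branch n x).mono hsub)
    have hmaps : Set.MapsTo (fun y ↦ g n (B.branch n x y)) (Metric.ball (f n x) (r - 2 * a))
        (Metric.ball (g n x) r) := by
      intro y hy
      have h1 := hfg n (B.branch n x y)
      rw [B.map_branch n x y (hsub hy), dist_comm] at h1
      rw [Metric.mem_ball] at hy ⊢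
      linarith [dist_triangle4 (g n (B.branch n x y)) y (f n x) (g n x), hfg n x]
    have hlift : Set.EqOn (fun y ↦ C.branch n x (g n (B.branch n x y))) (B.branch n x)
        (Metric.ball (f n x) (r - 2 * a)) := by
      refine C.eqOn_of_isPreconnected (hball _ _ _)
        ((C.continuousOn_branch n x).comp hgc hmaps) ((B.continuousOn_branch n x).mono hsub)
        (fun y hy ↦ C.map_branch n x _ (hmaps hy)) (p := f n x)
        (Metric.mem_ball_self (by linarith)) ?_
      simp only [B.branch_self, C.branch_self]
    have hself : C.branch n x (g n (H n x)) = H n x := by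
      have := hlift (x := H (n + 1) (g n x)) (by rw [Metric.mem_ball]; linarith)
      simpa only [← hH n x] using this
    have hgH : dist (g n (H n x)) (g n x) ≤ D + 3 * a := by
      have h1 := hfg n (H n x)
      rw [B.semiconj_of_fixed_point hfg (by linarith) hHD hH, dist_comm] at h1
      linarith [dist_triangle4 (g n (H n x)) (H (n + 1) (g n x)) (f n x) (g n x), hfg n x]
    rw [hK n (H n x), B.semiconj_of_fixed_point hfg (by linarith) hHD hH]
    refine C.branch_eq_branch hball hself (by linarith) ?_
    linarith [dist_triangle (K (n + 1) (H (n + 1) (g n x))) (g n x) (g n (H n x)),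
      hT (n + 1) (g n x), dist_comm (g n x) (g n (H n x))]
  have h0 : dist (K n (H n x)) x ≤ 0 / (1 - μ) := by
    refine le_div_of_le_mul_add (g := g) (d := fun n x ↦ dist (K n (H n x)) x) hμ hμ1 hT
      (fun n _ x ↦ ?_) (Nat.zero_le n) x
    have := C.dist_branch_self_le (x := x) (y := K (n + 1) (H (n + 1) (g n x)))
      (by rw [Metric.mem_ball]; linarith [hT (n + 1) (g n x)])
    rw [← hstep n x] at this
    linarith
  rw [zero_div] at h0
  exact dist_le_zero.1 h0

/-- Two sequences of maps with uniform branches which are uniformly close are conjugated by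
homeomorphisms close to the identity. -/
theorem exists_conjugacy [∀ n, CompleteSpace (X n)]
    (hball : ∀ (n : ℕ) (x : X n) (s : ℝ), IsPreconnected (Metric.ball x s))
    (B : InverseBranches f r μ) (C : InverseBranches g r μ) {a : ℝ} (hμ : 0 ≤ μ) (hμ1 : μ < 1)
    (ha : 0 ≤ a) (hfg : ∀ n x, dist (f n x) (g n x) ≤ a) (hr : 6 * (μ / (1 - μ) * a + a) < r) :
    ∃ H : (n : ℕ) → X n ≃ₜ X n, (∀ n x, f n (H n x) = H (n + 1) (g n x)) ∧
      ∀ (N : ℕ) (b : ℝ), (∀ n ≥ N, ∀ x, dist (f n x) (g n x) ≤ b) →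
        ∀ x, dist (H N x) x ≤ μ / (1 - μ) * b := by
  have h1 : 0 < 1 - μ := by linarith
  set D := μ / (1 - μ) * a with hDdef
  have hD0 : 0 ≤ D := by positivity
  have hD : μ * (D + a) ≤ D := by
    apply le_of_eq
    rw [hDdef]
    field_simp
    ring
  have hgf : ∀ n x, dist (g n x) (f n x) ≤ a := fun n x ↦ by rw [dist_comm]; exact hfg n x
  obtain ⟨H, hHc, hHD, hH⟩ := B.exists_fixed_point hball C.continuous hμ hμ1 hD0 ha hfg hD
    (by linarith)
  obtain ⟨K, hKc, hKD, hK⟩ := C.exists_fixed_point hball B.continuous hμ hμ1 hD0 ha hgf hD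
    (by linarith)
  refine ⟨fun n ↦ ⟨⟨H n, K n,
    B.leftInverse_fixed_points hball C hμ hμ1 hD0 ha hfg hr hHD hH hKD hK n,
    C.leftInverse_fixed_points hball B hμ hμ1 hD0 ha hgf hr hKD hK hHD hH n⟩, hHc n, hKc n⟩,
    B.semiconj_of_fixed_point hfg (by linarith) hHD hH, fun N b hb x ↦ ?_⟩
  exact B.dist_fixed_point_le hμ hμ1 hfg (by linarith) hHD hH hb x

/-- Expansivity: if the maps are moreover injective at a uniform scale, two orbits which stay close
forever have the same starting point. -/
lemma eq_of_dist_orbitMap_le (B : InverseBranches f r μ) (hμ : 0 ≤ μ) (hμ1 : μ < 1) {ρ c : ℝ}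
    (hρ : ∀ (n : ℕ) (x y : X n), dist x y < ρ → f n x = f n y → x = y) (hcr : c < r)
    (hcρ : 2 * c < ρ) {x y : X 0} (h : ∀ n, dist (orbitMap f n x) (orbitMap f n y) ≤ c) :
    x = y := by
  have hstep : ∀ n, dist (orbitMap f n x) (orbitMap f n y) ≤
      μ * dist (orbitMap f (n + 1) x) (orbitMap f (n + 1) y) := by
    intro n
    have hc := h (n + 1)
    simp only [orbitMap, Function.comp_apply] at hc ⊢
    set p := orbitMap f n x
    set q := orbitMap f n y
    have hmem : f n q ∈ Metric.ball (f n p) r := by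
      rw [Metric.mem_ball, dist_comm]; linarith
    have hd := B.dist_branch_self_le hmem
    rw [dist_comm (f n q)] at hd
    have hq : B.branch n p (f n q) = q := by
      refine hρ n _ _ ?_ (B.map_branch n p _ hmem)
      have : μ * dist (f n p) (f n q) ≤ 1 * c :=
        mul_le_mul hμ1.le hc dist_nonneg zero_le_one
      linarith [dist_triangle (B.branch n p (f n q)) p q, h n]
    rwa [hq, dist_comm] at hd
  have hpow : ∀ n, dist x y ≤ μ ^ n * c := by
    have : ∀ n, dist x y ≤ μ ^ n * dist (orbitMap f n x) (orbitMap f n y) := by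
      intro n
      induction n with
      | zero => simp [orbitMap]
      | succ n ih =>
        calc dist x y ≤ _ := ih
          _ ≤ μ ^ n * (μ * _) := mul_le_mul_of_nonneg_left (hstep n) (by positivity)
          _ = _ := by ring
    exact fun n ↦ (this n).trans (mul_le_mul_of_nonneg_left (h n) (by positivity))
  have hlim : Filter.Tendsto (fun n : ℕ ↦ μ ^ n * c) Filter.atTop (nhds 0) := by
    simpa using (tendsto_pow_atTop_nhds_zero_of_lt_one hμ hμ1).mul_const c
  exact dist_le_zero.1 (ge_of_tendsto' hlim hpow)

/-- The branches restricted to smaller balls, with a larger Lipschitz constant. -/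
def mono (B : InverseBranches f r μ) {r' μ' : ℝ} (hr : r' ≤ r) (hμ : μ ≤ μ') :
    InverseBranches f r' μ' where
  continuous := B.continuous
  locallyInjective := B.locallyInjective
  branch := B.branch
  branch_self := B.branch_self
  map_branch n x y hy := B.map_branch n x y (Metric.ball_subset_ball hr hy)
  dist_branch_le n x y hy z hz :=
    (B.dist_branch_le n x y (Metric.ball_subset_ball hr hy) z
      (Metric.ball_subset_ball hr hz)).trans (mul_le_mul_of_nonneg_right hμ dist_nonneg)

/-- The branches of a shifted sequence. -/
def shift (B : InverseBranches f r μ) (m : ℕ) :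
    InverseBranches (X := fun k ↦ X (m + k)) (SeqDyn.shift f m) r μ where
  continuous k := B.continuous (m + k)
  locallyInjective k := B.locallyInjective (m + k)
  branch k := B.branch (m + k)
  branch_self k := B.branch_self (m + k)
  map_branch k := B.map_branch (m + k)
  dist_branch_le k := B.dist_branch_le (m + k)

/-- At most one homeomorphism is `η`-conjugating for `(f, g)`. -/
lemma isConjugatingHomeo_unique (B : InverseBranches f r μ) (hμ : 0 ≤ μ) (hμ1 : μ < 1) {ρ η : ℝ}
    (hρ : ∀ (n : ℕ) (x y : X n), dist x y < ρ → f n x = f n y → x = y) (hηr : 4 * η < r)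
    (hηρ : 8 * η < ρ) (hη : 0 ≤ η) {h h' : X 0 ≃ₜ X 0} (hh : IsConjugatingHomeo η f g h)
    (hh' : IsConjugatingHomeo η f g h') : h = h' := by
  obtain ⟨H, rfl, hH, hHd⟩ := hh
  obtain ⟨K, rfl, hK, hKd⟩ := hh'
  ext x
  refine B.eq_of_dist_orbitMap_le hμ hμ1 hρ (c := 2 * η) (by linarith) (by linarith) fun n ↦ ?_
  have e1 : orbitMap f n (H 0 x) = H n (orbitMap g n x) := (congrFun (hH n) x).symm
  have e2 : orbitMap f n (K 0 x) = K n (orbitMap g n x) := (congrFun (hK n) x).symm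
  rw [e1, e2]
  linarith [dist_triangle_right (H n (orbitMap g n x)) (K n (orbitMap g n x)) (orbitMap g n x),
    hHd n (orbitMap g n x), hKd n (orbitMap g n x)]

/-- At most one homeomorphism is `η`-conjugating for `(g, f)` if some homeomorphism is
`η`-conjugating for `(f, g)`: the latter carries orbits of `g` to orbits of the expansive `f`. -/
lemma isConjugatingHomeo_unique' (B : InverseBranches f r μ) (hμ : 0 ≤ μ) (hμ1 : μ < 1) {ρ η : ℝ}
    (hρ : ∀ (n : ℕ) (x y : X n), dist x y < ρ → f n x = f n y → x = y) (hηr : 4 * η < r)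
    (hηρ : 8 * η < ρ) {h₀ : X 0 ≃ₜ X 0} (hh₀ : IsConjugatingHomeo η f g h₀)
    {h h' : X 0 ≃ₜ X 0} (hh : IsConjugatingHomeo η g f h)
    (hh' : IsConjugatingHomeo η g f h') : h = h' := by
  obtain ⟨J, rfl, hJ, hJd⟩ := hh₀
  obtain ⟨H, rfl, hH, hHd⟩ := hh
  obtain ⟨K, rfl, hK, hKd⟩ := hh'
  ext x
  refine (J 0).injective ?_
  refine B.eq_of_dist_orbitMap_le hμ hμ1 hρ (c := 4 * η) (by linarith) (by linarith) fun n ↦ ?_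
  have e1 : orbitMap f n (J 0 (H 0 x)) = J n (H n (orbitMap f n x)) := by
    rw [show J n (H n (orbitMap f n x)) = J n (orbitMap g n (H 0 x)) from
      congrArg (J n) (congrFun (hH n) x)]
    exact (congrFun (hJ n) (H 0 x)).symm
  have e2 : orbitMap f n (J 0 (K 0 x)) = J n (K n (orbitMap f n x)) := by
    rw [show J n (K n (orbitMap f n x)) = J n (orbitMap g n (K 0 x)) from
      congrArg (J n) (congrFun (hK n) x)]
    exact (congrFun (hJ n) (K 0 x)).symm
  rw [e1, e2]
  set y := orbitMap f n x
  linarith [dist_triangle_right (J n (H n y)) (J n (K n y)) y,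
    dist_triangle (J n (H n y)) (H n y) y, dist_triangle (J n (K n y)) (K n y) y,
    hHd n y, hKd n y, hJd n (H n y), hJd n (K n y)]

end InverseBranches

lemma IsExpandingSeq.exists_inverseBranches {f : (n : ℕ) → X n → X (n + 1)} {lam : ℕ → ℝ}
    (hf : IsExpandingSeq f lam) {μ : ℝ} (hμ : ∀ n, lam n ≤ μ) :
    ∃ δ > 0, Nonempty (InverseBranches f δ μ) := by
  obtain ⟨hc, -, -, δ, hδ, h⟩ := hf
  choose V φ hV hxV hbij hinv hlip using fun n (x : X n) ↦ h n (f n x) x rfl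
  exact ⟨δ, hδ, ⟨{
    continuous := hc
    locallyInjective := fun n x ↦ ⟨V n x, hV n x, hxV n x, (hbij n x).injOn⟩
    branch := φ
    branch_self := fun n x ↦ (hinv n x).1 (hxV n x)
    map_branch := fun n x y hy ↦ (hinv n x).2 hy
    dist_branch_le := fun n x y hy z hz ↦ (hlip n x y hy z hz).trans
      (mul_le_mul_of_nonneg_right (hμ n) dist_nonneg) }⟩⟩

end Metric

/-! ### Lipschitz estimates on Riemannian manifolds -/

section Lipschitz

open Manifold

variable {E : Type*} [NormedAddCommGroup E] [NormedSpace ℝ E]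
  {M : Type*} [PseudoEMetricSpace M] [ChartedSpace E M]
  [RiemannianBundle (fun x : M ↦ TangentSpace 𝓘(ℝ, E) x)]
  {E' : Type*} [NormedAddCommGroup E'] [NormedSpace ℝ E']
  {M' : Type*} [PseudoEMetricSpace M'] [ChartedSpace E' M']
  [RiemannianBundle (fun x : M' ↦ TangentSpace 𝓘(ℝ, E') x)]

/-- Two points at distance `< c` are joined by a `C^1` path of length `< c`, all of whose points
are at distance `< c` from the first one. -/
lemma exists_path_of_edist_lt [IsRiemannianManifold 𝓘(ℝ, E) M] {y z : M} {c : ℝ≥0∞}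
    (h : edist y z < c) :
    ∃ γ : ℝ → M, γ 0 = y ∧ γ 1 = z ∧ ContMDiffOn 𝓘(ℝ, ℝ) 𝓘(ℝ, E) 1 γ (Set.Icc 0 1) ∧
      pathELength 𝓘(ℝ, E) γ 0 1 < c ∧ ∀ t ∈ Set.Icc (0 : ℝ) 1, edist (γ t) y < c := by
  rw [IsRiemannianManifold.out (I := 𝓘(ℝ, E)) y z] at h
  obtain ⟨γ, h0, h1, hγ, hc⟩ := exists_lt_of_riemannianEDist_lt h
  refine ⟨γ, h0, h1, hγ, hc, fun t ht ↦ ?_⟩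
  rw [edist_comm, IsRiemannianManifold.out (I := 𝓘(ℝ, E)) y]
  calc riemannianEDist 𝓘(ℝ, E) y (γ t) ≤ pathELength 𝓘(ℝ, E) γ 0 t :=
        riemannianEDist_le_pathELength (hγ.mono (Set.Icc_subset_Icc le_rfl ht.2)) h0 rfl ht.1
    _ ≤ pathELength 𝓘(ℝ, E) γ 0 1 := pathELength_mono le_rfl ht.2
    _ < c := hc

variable (E) in
lemma isPreconnected_eball [IsRiemannianManifold 𝓘(ℝ, E) M] (x : M) (s : ℝ≥0∞) :
    IsPreconnected (Metric.eball x s) := by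
  refine isPreconnected_of_forall x fun z hz ↦ ?_
  rw [Metric.mem_eball'] at hz
  obtain ⟨γ, h0, h1, hγ, -, hs⟩ := exists_path_of_edist_lt (E := E) hz
  refine ⟨γ '' Set.Icc 0 1, ?_, ⟨0, by simp, h0⟩, ⟨1, by simp, h1⟩,
    isPreconnected_Icc.image _ hγ.continuousOn⟩
  rintro _ ⟨t, ht, rfl⟩
  exact hs t ht

/-- A bound on the derivative of a map on a ball bounds the distance of the images of the centre
and of any point of the ball. -/
lemma edist_le_of_mfderiv_le [IsManifold 𝓘(ℝ, E) 1 M]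
    [IsRiemannianManifold 𝓘(ℝ, E) M] [IsRiemannianManifold 𝓘(ℝ, E') M'] {h : M → M'}
    {y z : M} {s : ℝ≥0∞} (hyz : edist y z < s)
    (hh : ContMDiffOn 𝓘(ℝ, E) 𝓘(ℝ, E') 1 h (Metric.eball y s)) {K : NNReal}
    (hK : ∀ p ∈ Metric.eball y s, ∀ w : TangentSpace 𝓘(ℝ, E) p,
      ‖mfderiv 𝓘(ℝ, E) 𝓘(ℝ, E') h p w‖ₑ ≤ K * ‖w‖ₑ) :
    edist (h y) (h z) ≤ K * edist y z := by
  have key : ∀ c ∈ Set.Ioo (edist y z) s, edist (h y) (h z) ≤ K * c := by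
    rintro c ⟨hc, hcs⟩
    obtain ⟨γ, h0, h1, hγ, hγc, hγb⟩ := exists_path_of_edist_lt (E := E) hc
    have hmaps : Set.MapsTo γ (Set.Icc 0 1) (Metric.eball y s) := fun t ht ↦ (hγb t ht).trans hcs
    have hhγ : ContMDiffOn 𝓘(ℝ, ℝ) 𝓘(ℝ, E') 1 (h ∘ γ) (Set.Icc 0 1) := hh.comp hγ hmaps
    rw [IsRiemannianManifold.out (I := 𝓘(ℝ, E')) (h y)]
    refine (riemannianEDist_le_pathELength hhγ (by simp [h0]) (by simp [h1]) zero_le_one).trans ?_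
    refine le_trans ?_ (mul_le_mul_right hγc.le (K : ℝ≥0∞))
    rw [pathELength_eq_lintegral_mfderivWithin_Icc, pathELength_eq_lintegral_mfderivWithin_Icc,
      ← MeasureTheory.lintegral_const_mul' _ _ ENNReal.coe_ne_top]
    refine MeasureTheory.setLIntegral_mono' measurableSet_Icc fun t ht ↦ ?_
    have hht : MDifferentiableAt 𝓘(ℝ, E) 𝓘(ℝ, E') h (γ t) :=
      ((hh.contMDiffAt (Metric.isOpen_eball.mem_nhds (hmaps ht))).mdifferentiableAt one_ne_zero)
    have hcomp := mfderiv_comp_mfderivWithin t hht (hγ.mdifferentiableOn one_ne_zero t ht)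
      ((uniqueMDiffWithinAt_iff_uniqueDiffWithinAt).2 (uniqueDiffOn_Icc zero_lt_one t ht))
    rw [hcomp]
    exact hK _ (hmaps ht) _
  have hne : (nhdsWithin (edist y z) (Set.Ioi (edist y z))).NeBot :=
    nhdsGT_neBot_of_exists_gt ⟨s, hyz⟩
  have hlim : Filter.Tendsto (fun c : ℝ≥0∞ ↦ (K : ℝ≥0∞) * c)
      (nhdsWithin (edist y z) (Set.Ioi (edist y z))) (nhds (K * edist y z)) :=
    ((ENNReal.continuous_const_mul ENNReal.coe_ne_top).tendsto _).mono_left nhdsWithin_le_nhds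
  exact ge_of_tendsto hlim (Filter.eventually_of_mem (Ioo_mem_nhdsGT hyz) key)

end Lipschitz

/-! ### The derivative of an expanding map -/

section Sharp

open Manifold Topology

variable {E : Type*} [NormedAddCommGroup E] [NormedSpace ℝ E]
  {M : Type*} [PseudoEMetricSpace M] [ChartedSpace E M] [IsManifold 𝓘(ℝ, E) 1 M]
  [RiemannianBundle (fun x : M ↦ TangentSpace 𝓘(ℝ, E) x)]

lemma continuousAt_norm_mfderiv
    [IsContinuousRiemannianBundle E (fun x : M ↦ TangentSpace 𝓘(ℝ, E) x)] {b : ℝ → M}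
    (hb : ContMDiffAt 𝓘(ℝ, ℝ) 𝓘(ℝ, E) 1 b 0) :
    ContinuousAt (fun t : ℝ ↦ ‖mfderiv 𝓘(ℝ, ℝ) 𝓘(ℝ, E) b t (1 : ℝ)‖) 0 := by
  obtain ⟨U, hU, hbU⟩ := (contMDiffAt_iff_contMDiffOn_nhds (by simp)).1 hb
  obtain ⟨V, hVU, hVo, h0V⟩ := mem_nhds_iff.1 hU
  have hbV := hbU.mono hVU
  have h1 := hbV.continuousOn_tangentMapWithin le_rfl hVo.uniqueMDiffOn
  have h2 : Continuous fun t : ℝ ↦ (⟨t, (1 : ℝ)⟩ : TangentBundle 𝓘(ℝ, ℝ) ℝ) :=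
    (tangentBundleModelSpaceHomeomorph 𝓘(ℝ, ℝ)).symm.continuous.comp
      (continuous_id.prodMk continuous_const)
  have h3 : ContinuousOn (fun t : ℝ ↦
      (⟨b t, mfderivWithin 𝓘(ℝ, ℝ) 𝓘(ℝ, E) b V t (1 : ℝ)⟩ : TangentBundle 𝓘(ℝ, E) M)) V :=
    h1.comp h2.continuousOn fun t ht ↦ ht
  have h4 := (h3.inner_bundle h3).sqrt
  refine (h4.continuousAt (hVo.mem_nhds h0V)).congr ?_
  filter_upwards [hVo.mem_nhds h0V] with t ht
  rw [mfderivWithin_of_isOpen hVo ht, norm_eq_sqrt_real_inner]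

/-- A `C^1` curve moves at most as fast as its speed. -/
lemma eventually_edist_curve_le
    [IsContinuousRiemannianBundle E (fun x : M ↦ TangentSpace 𝓘(ℝ, E) x)]
    [IsRiemannianManifold 𝓘(ℝ, E) M] {b : ℝ → M}
    (hb : ContMDiffAt 𝓘(ℝ, ℝ) 𝓘(ℝ, E) 1 b 0) {K : NNReal}
    (hK : ‖mfderiv 𝓘(ℝ, ℝ) 𝓘(ℝ, E) b 0 (1 : ℝ)‖ < K) :
    ∀ᶠ t in 𝓝 (0 : ℝ), edist (b 0) (b t) ≤ K * edist 0 t := by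
  have h1 := (continuousAt_norm_mfderiv hb).eventually (gt_mem_nhds hK)
  have h2 := (contMDiffAt_iff_contMDiffAt_nhds (by simp)).1 hb
  obtain ⟨s, hs, hsub⟩ := EMetric.mem_nhds_iff.1 (h1.and h2)
  filter_upwards [Metric.eball_mem_nhds (0 : ℝ) hs] with t ht
  refine edist_le_of_mfderiv_le (E := ℝ) (E' := E) (s := s) (by rwa [edist_comm])
    (fun p hp ↦ (hsub hp).2.contMDiffWithinAt) fun p hp ↦ ?_
  have key : ∀ w : ℝ, ‖mfderiv 𝓘(ℝ, ℝ) 𝓘(ℝ, E) b p w‖ₑ ≤ K * ‖w‖ₑ := fun w ↦ by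
    have hw : mfderiv 𝓘(ℝ, ℝ) 𝓘(ℝ, E) b p w =
        w • mfderiv 𝓘(ℝ, ℝ) 𝓘(ℝ, E) b p (1 : ℝ) :=
      (congrArg (mfderiv 𝓘(ℝ, ℝ) 𝓘(ℝ, E) b p) (mul_one w).symm).trans
        ((mfderiv 𝓘(ℝ, ℝ) 𝓘(ℝ, E) b p).map_smul w (1 : ℝ))
    rw [hw, enorm_smul, mul_comm]
    refine mul_le_mul_left ?_ _
    have := (hsub hp).1
    simp only [enorm]
    exact_mod_cast this.le
  exact fun w ↦ (key w).trans_eq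
    (congrArg ((K : ℝ≥0∞) * ·) (enorm_tangentSpace_vectorSpace (x := p) (v := w)).symm)

/-- The linear coordinate in the direction `v` in the chart at `x`: a function whose derivative
at `x` is `⟪v, ·⟫`. -/
def coord (x : M) (v : TangentSpace 𝓘(ℝ, E) x) : M → ℝ :=
  fun y ↦ inner ℝ v
    ((trivializationAt E (TangentSpace 𝓘(ℝ, E)) x).symmL ℝ x (extChartAt 𝓘(ℝ, E) x y))

lemma mfderiv_coord (x : M) (v : TangentSpace 𝓘(ℝ, E) x) {y : M} (hy : y ∈ (chartAt E x).source)
    (w : TangentSpace 𝓘(ℝ, E) y) :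
    ContMDiffAt 𝓘(ℝ, E) 𝓘(ℝ, ℝ) 1 (coord x v) y ∧
      mfderiv 𝓘(ℝ, E) 𝓘(ℝ, ℝ) (coord x v) y w =
        (inner ℝ v (((trivializationAt E (TangentSpace 𝓘(ℝ, E)) x).symmL ℝ x ∘L
          ((trivializationAt E (TangentSpace 𝓘(ℝ, E)) x).continuousLinearMapAt ℝ y)) w) : ℝ) := by
  let ℓ : E →L[ℝ] ℝ := (innerSL ℝ v).comp ((trivializationAt E (TangentSpace 𝓘(ℝ, E)) x).symmL ℝ x)
  have hc : coord x v = ℓ ∘ extChartAt 𝓘(ℝ, E) x := rfl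
  have h1 : ContMDiffAt 𝓘(ℝ, E) 𝓘(ℝ, E) 1 (extChartAt 𝓘(ℝ, E) x) y := contMDiffAt_extChartAt' hy
  refine ⟨ℓ.contMDiff.contMDiffAt.comp y h1, ?_⟩
  rw [hc, mfderiv_comp y ℓ.mdifferentiableAt (h1.mdifferentiableAt one_ne_zero),
    TangentBundle.continuousLinearMapAt_trivializationAt hy, ContinuousLinearMap.mfderiv_eq]
  rfl

/-- Near `x`, the coordinate in the direction `v` is Lipschitz with a constant as close to `‖v‖` as
desired, since the metric is continuous. -/
lemma eventually_coord_le
    [IsContinuousRiemannianBundle E (fun x : M ↦ TangentSpace 𝓘(ℝ, E) x)]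
    [IsRiemannianManifold 𝓘(ℝ, E) M] (x : M) (v : TangentSpace 𝓘(ℝ, E) x)
    {r : NNReal} (hr : 1 < r) :
    ∀ᶠ y in 𝓝 x, edist (coord x v x) (coord x v y) ≤ (r * ‖v‖₊ : NNReal) * edist x y := by
  have h1 := eventually_norm_symmL_trivializationAt_self_comp_lt E
    (fun x : M ↦ TangentSpace 𝓘(ℝ, E) x) x (r := r) hr
  have h2 : ∀ᶠ y in 𝓝 x, y ∈ (chartAt E x).source := chart_source_mem_nhds E x
  obtain ⟨s, hs, hsub⟩ := EMetric.mem_nhds_iff.1 (h1.and h2)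
  filter_upwards [Metric.eball_mem_nhds x hs] with y hy
  refine edist_le_of_mfderiv_le (E := E) (E' := ℝ) (s := s) (by rwa [edist_comm])
    (fun p hp ↦ (mfderiv_coord x v (hsub hp).2 0).1.contMDiffWithinAt) fun p hp w ↦ ?_
  refine (enorm_tangentSpace_vectorSpace (x := coord x v p)).trans_le ?_
  refine (congrArg (fun a : ℝ ↦ ‖a‖ₑ) (mfderiv_coord x v (hsub hp).2 w).2).trans_le ?_
  simp only [enorm]
  rw [← ENNReal.coe_mul, ENNReal.coe_le_coe, ← NNReal.coe_le_coe]
  refine (norm_inner_le_norm v _).trans ?_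
  have h3 := ContinuousLinearMap.le_of_opNorm_le _ (hsub hp).1.le w
  calc _ ≤ ‖v‖ * (r * ‖w‖) := mul_le_mul_of_nonneg_left h3 (norm_nonneg v)
    _ = _ := by push_cast; ring

/-- A `C^1` curve with initial velocity `v`, a straight line in the chart at `x`, along which the
coordinate in the direction `v` is affine. -/
lemma exists_curve (x : M) (v : TangentSpace 𝓘(ℝ, E) x) :
    ∃ (c : ℝ → M) (L : ℝ →L[ℝ] E), c 0 = x ∧ ContMDiffAt 𝓘(ℝ, ℝ) 𝓘(ℝ, E) 1 c 0 ∧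
      HasMFDerivAt 𝓘(ℝ, ℝ) 𝓘(ℝ, E) c 0 L ∧ L 1 = v ∧
      ∀ᶠ t in 𝓝 (0 : ℝ), coord x v (c t) - coord x v x = t * ‖v‖ ^ 2 := by
  set e := trivializationAt E (TangentSpace 𝓘(ℝ, E) (M := M)) x
  have hx : x ∈ (chartAt E x).source := mem_chart_source E x
  have hxe : x ∈ e.baseSet := mem_baseSet_trivializationAt E _ x
  set w : E := e.continuousLinearMapAt ℝ x v with hw
  have hwv : e.symmL ℝ x w = v := e.symmL_continuousLinearMapAt hxe v
  set φ := extChartAt 𝓘(ℝ, E) x with hφ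
  let l : ℝ → E := fun t ↦ φ x + t • w
  have hl0 : l 0 = φ x := by simp [l]
  have hl : HasFDerivAt l (ContinuousLinearMap.smulRight (1 : ℝ →L[ℝ] ℝ) w) 0 :=
    ((hasDerivAt_id (0 : ℝ)).smul_const w |>.const_add (φ x)).hasFDerivAt.congr_fderiv (by
      ext; simp)
  have hlc : ContDiff ℝ 1 l := by fun_prop
  have htgt : φ.target ∈ 𝓝 (l 0) := hl0 ▸ extChartAt_target_mem_nhds x
  have hsymm : ContMDiffAt 𝓘(ℝ, E) 𝓘(ℝ, E) 1 φ.symm (l 0) :=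
    (contMDiffOn_extChartAt_symm x).contMDiffAt htgt
  have hD : HasMFDerivAt 𝓘(ℝ, E) 𝓘(ℝ, E) φ.symm (l 0) (e.symmL ℝ x) := by
    have h1 := (hsymm.mdifferentiableAt one_ne_zero).hasMFDerivAt
    have h2 : mfderiv 𝓘(ℝ, E) 𝓘(ℝ, E) φ.symm (l 0) = e.symmL ℝ x := by
      have h3 := TangentBundle.symmL_trivializationAt (I := 𝓘(ℝ, E)) (𝕜 := ℝ) hx
      rw [modelWithCornersSelf_coe, Set.range_id, mfderivWithin_univ] at h3
      rw [hl0]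
      exact h3.symm
    exact h2 ▸ h1
  refine ⟨φ.symm ∘ l, _, by simp [hl0, φ], hsymm.comp 0 hlc.contMDiff.contMDiffAt,
    hD.comp 0 hl.hasMFDerivAt, ?_, ?_⟩
  · exact (congrArg (e.symmL ℝ x) (one_smul ℝ w)).trans hwv
  · have hl_cont : ContinuousAt l 0 := hlc.continuous.continuousAt
    filter_upwards [hl_cont.eventually htgt] with t ht
    have h1 : φ (φ.symm (l t)) = φ x + t • w := φ.right_inv ht
    have h2 : e.symmL ℝ x (φ x + t • w) = e.symmL ℝ x (φ x) + t • v := by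
      rw [map_add, map_smul, hwv]
    calc coord x v (φ.symm (l t)) - coord x v x
        = inner ℝ v (e.symmL ℝ x (φ (φ.symm (l t)))) - inner ℝ v (e.symmL ℝ x (φ x)) := rfl
      _ = t * ‖v‖ ^ 2 := by
        rw [h1, h2, inner_add_right, inner_smul_right, real_inner_self_eq_norm_sq]
        ring

/-- If the `C^1` map `f` expands distances to `x` by the factor `lam⁻¹`, then its derivative at `x`
expands norms by this factor. Distances along a curve leaving `x` with velocity `v` are bounded
from below by means of the coordinate in the direction `v`, and the distances of the images are
bounded from above by the speed of the image curve. -/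
lemma norm_le_mul_norm_mfderiv
    [IsContinuousRiemannianBundle E (fun x : M ↦ TangentSpace 𝓘(ℝ, E) x)]
    [IsRiemannianManifold 𝓘(ℝ, E) M]
    {E' : Type*} [NormedAddCommGroup E'] [NormedSpace ℝ E']
    {M' : Type*} [PseudoEMetricSpace M'] [ChartedSpace E' M'] [IsManifold 𝓘(ℝ, E') 1 M']
    [RiemannianBundle (fun x : M' ↦ TangentSpace 𝓘(ℝ, E') x)]
    [IsContinuousRiemannianBundle E' (fun x : M' ↦ TangentSpace 𝓘(ℝ, E') x)]
    [IsRiemannianManifold 𝓘(ℝ, E') M'] {f : M → M'} {x : M}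
    (hf : ContMDiffAt 𝓘(ℝ, E) 𝓘(ℝ, E') 1 f x) {lam : NNReal}
    (hlam : ∀ᶠ y in 𝓝 x, edist x y ≤ lam * edist (f x) (f y)) (v : TangentSpace 𝓘(ℝ, E) x) :
    ‖v‖ ≤ lam * ‖mfderiv 𝓘(ℝ, E) 𝓘(ℝ, E') f x v‖ := by
  rcases eq_or_ne v 0 with rfl | hv
  · simp
  have hv0 : 0 < ‖v‖ := norm_pos_iff.2 hv
  obtain ⟨c, L, hc0, hc, hcL, hL, hcoord⟩ := exists_curve x v
  have hfc : ContMDiffAt 𝓘(ℝ, ℝ) 𝓘(ℝ, E') 1 (f ∘ c) 0 := ContMDiffAt.comp 0 (hc0 ▸ hf) hc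
  have hspeed : ‖mfderiv 𝓘(ℝ, ℝ) 𝓘(ℝ, E') (f ∘ c) 0 (1 : ℝ)‖ =
      ‖mfderiv 𝓘(ℝ, E) 𝓘(ℝ, E') f x v‖ := by
    subst hc0
    rw [(((hf.mdifferentiableAt one_ne_zero).hasMFDerivAt).comp 0 hcL).mfderiv, ← hL]
    rfl
  set k := ‖mfderiv 𝓘(ℝ, E) 𝓘(ℝ, E') f x v‖
  have key : ∀ e : ℝ, 0 < e → ‖v‖ ≤ (1 + e) * lam * (k + e) := by
    intro e he
    have hc_tendsto : Filter.Tendsto c (𝓝 0) (𝓝 x) := by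
      have := hc.continuousAt
      rwa [ContinuousAt, hc0] at this
    have h1 := hc_tendsto.eventually (eventually_coord_le x v (r := 1 + e.toNNReal) (by simpa))
    have h2 := hc_tendsto.eventually hlam
    have h3 := eventually_edist_curve_le hfc (K := (k + e).toNNReal) (by
      rw [hspeed, Real.coe_toNNReal _ (by positivity)]; linarith)
    obtain ⟨t, ht0, ⟨⟨h1, h2⟩, h3⟩, h4⟩ : ∃ t > (0 : ℝ), _ :=
      (Filter.Eventually.and (eventually_mem_nhdsWithin (s := Set.Ioi (0 : ℝ)))
        ((((h1.and h2).and h3).and hcoord).filter_mono nhdsWithin_le_nhds)).exists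
    -- Both estimates together bound the increment `t * ‖v‖ ^ 2` of the coordinate.
    have h5 : edist (coord x v x) (coord x v (c t)) ≤
        ((1 + e.toNNReal) * ‖v‖₊ : NNReal) * (lam * ((k + e).toNNReal * edist 0 t)) := by
      refine h1.trans (mul_le_mul_right (h2.trans (mul_le_mul_right ?_ _)) _)
      simpa [hc0] using h3
    rw [edist_comm, edist_dist, edist_comm, edist_dist, Real.dist_eq, h4, Real.dist_eq, sub_zero,
      abs_of_pos ht0, abs_of_pos (by positivity)] at h5
    have h6 : t * ‖v‖ ^ 2 ≤ (1 + e) * ‖v‖ * (lam * ((k + e) * t)) := by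
      have := ENNReal.toReal_mono (by finiteness) h5
      rwa [ENNReal.toReal_mul, ENNReal.toReal_mul, ENNReal.toReal_mul, ENNReal.coe_toReal,
        ENNReal.coe_toReal, ENNReal.coe_toReal, ENNReal.toReal_ofReal (by positivity),
        ENNReal.toReal_ofReal ht0.le, Real.coe_toNNReal _ (by positivity), NNReal.coe_mul,
        NNReal.coe_add, Real.coe_toNNReal _ he.le, NNReal.coe_one, coe_nnnorm] at this
    have h7 : (t * ‖v‖) * ‖v‖ ≤ (t * ‖v‖) * ((1 + e) * lam * (k + e)) := by
      calc _ = t * ‖v‖ ^ 2 := by ring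
        _ ≤ _ := h6
        _ = _ := by ring
    exact le_of_mul_le_mul_left h7 (by positivity)
  have hlim : Filter.Tendsto (fun e : ℝ ↦ (1 + e) * lam * (k + e)) (𝓝[>] 0) (𝓝 (lam * k)) := by
    have : Continuous fun e : ℝ ↦ (1 + e) * lam * (k + e) := by fun_prop
    have h := this.tendsto 0
    simp only [add_zero, one_mul] at h
    exact h.mono_left nhdsWithin_le_nhds
  exact ge_of_tendsto hlim (Filter.eventually_of_mem self_mem_nhdsWithin key)

end Sharp

/-! ### Local inverses of `C^1` maps between manifolds -/

section LocalInverse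

open Manifold Topology

variable {E : Type*} [NormedAddCommGroup E] [NormedSpace ℝ E]
  {M : Type*} [TopologicalSpace M] [ChartedSpace E M]
  {E' : Type*} [NormedAddCommGroup E'] [NormedSpace ℝ E']
  {M' : Type*} [TopologicalSpace M'] [ChartedSpace E' M']

lemma contDiffAt_writtenInExtChartAt {f : M → M'} {x : M}
    (hf : ContMDiffAt 𝓘(ℝ, E) 𝓘(ℝ, E') 1 f x) :
    ContDiffAt ℝ 1 (writtenInExtChartAt 𝓘(ℝ, E) 𝓘(ℝ, E') x f) (extChartAt 𝓘(ℝ, E) x x) := by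
  have h := (contMDiffAt_iff.1 hf).2
  rwa [modelWithCornersSelf_coe, Set.range_id, contDiffWithinAt_univ] at h

/-- A `C^1` map with a local section cannot raise the dimension. -/
lemma finrank_le_of_section [FiniteDimensional ℝ E] [FiniteDimensional ℝ E']
    {f : M → M'} {x : M} (hf : ContMDiffAt 𝓘(ℝ, E) 𝓘(ℝ, E') 1 f x)
    {φ : M' → M} (hφ : ContinuousAt φ (f x)) (hφx : φ (f x) = x)
    (h : ∀ᶠ y in 𝓝 (f x), f (φ y) = y) :
    Module.finrank ℝ E' ≤ Module.finrank ℝ E := by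
  by_contra! hlt
  set F := writtenInExtChartAt 𝓘(ℝ, E) 𝓘(ℝ, E') x f with hF
  have hFx := contDiffAt_writtenInExtChartAt hf
  obtain ⟨r, hr, hball⟩ := Metric.eventually_nhds_iff_ball.1 (hFx.eventually (by simp))
  set s := Metric.ball (extChartAt 𝓘(ℝ, E) x x) r
  have hFs : ContDiffOn ℝ 1 F s := fun z hz ↦ (hball z hz).contDiffWithinAt
  have hdense : Dense (F '' s)ᶜ := by
    refine hFs.dense_compl_image_of_dimH_lt_finrank (convex_ball _ _) subset_rfl ?_
    exact ((dimH_mono (Set.subset_univ s)).trans_eq (Real.dimH_univ_eq_finrank E)).trans_lt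
      (by exact_mod_cast hlt)
  set ψ := extChartAt 𝓘(ℝ, E') (f x)
  have hψ : Filter.Tendsto ψ.symm (𝓝 (ψ (f x))) (𝓝 (f x)) := by
    have := continuousAt_extChartAt_symm (I := 𝓘(ℝ, E')) (f x)
    rwa [ContinuousAt, extChartAt_to_inv] at this
  have hφt : Filter.Tendsto φ (𝓝 (f x)) (𝓝 x) := by
    have := hφ
    rwa [ContinuousAt, hφx] at this
  -- Read in the charts, the section shows that the image of a ball is a neighbourhood.
  have hmem : F '' s ∈ 𝓝 (ψ (f x)) := by
    filter_upwards [extChartAt_target_mem_nhds (I := 𝓘(ℝ, E')) (f x), hψ.eventually h,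
      (hφt.comp hψ).eventually (extChartAt_source_mem_nhds (I := 𝓘(ℝ, E)) x),
      (((continuousAt_extChartAt (I := 𝓘(ℝ, E)) x).tendsto.comp hφt).comp hψ).eventually
        (Metric.ball_mem_nhds _ hr)] with z hz1 hz2 hz3 hz4
    refine ⟨_, hz4, ?_⟩
    simp only [Function.comp_apply] at hz3 ⊢
    rw [hF, writtenInExtChartAt]
    simp only [Function.comp_apply]
    rw [(extChartAt 𝓘(ℝ, E) x).left_inv hz3, hz2]
    exact ψ.right_inv hz1
  obtain ⟨z, hz1, hz2⟩ := (mem_closure_iff_nhds.1 (hdense (ψ (f x)))) _ hmem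
  exact hz2 hz1

/-- The inverse function theorem on manifolds without boundary. -/
lemma exists_openPartialHomeomorph_of_injective_mfderiv [FiniteDimensional ℝ E]
    [FiniteDimensional ℝ E'] [IsManifold 𝓘(ℝ, E) 1 M] [IsManifold 𝓘(ℝ, E') 1 M'] {f : M → M'}
    (hf : ContMDiff 𝓘(ℝ, E) 𝓘(ℝ, E') 1 f) (x : M)
    (hinj : Function.Injective (mfderiv 𝓘(ℝ, E) 𝓘(ℝ, E') f x))
    (hdim : Module.finrank ℝ E = Module.finrank ℝ E') :
    ∃ e : OpenPartialHomeomorph M M', x ∈ e.source ∧ Set.EqOn f e e.source ∧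
      ContMDiffAt 𝓘(ℝ, E') 𝓘(ℝ, E) 1 e.symm (f x) := by
  have hfx : ContMDiffAt 𝓘(ℝ, E) 𝓘(ℝ, E') 1 f x := hf x
  set F := writtenInExtChartAt 𝓘(ℝ, E) 𝓘(ℝ, E') x f with hF
  have hFx := contDiffAt_writtenInExtChartAt hfx
  let A : E →L[ℝ] E' := mfderiv 𝓘(ℝ, E) 𝓘(ℝ, E') f x
  have hA : HasFDerivAt F A (extChartAt 𝓘(ℝ, E) x x) := by
    have h : HasFDerivWithinAt F A (Set.range 𝓘(ℝ, E)) (extChartAt 𝓘(ℝ, E) x x) :=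
      (hfx.mdifferentiableAt one_ne_zero).hasMFDerivAt.2
    rwa [modelWithCornersSelf_coe, Set.range_id, hasFDerivWithinAt_univ] at h
  let A' : E ≃L[ℝ] E' :=
    (LinearEquiv.ofInjectiveOfFinrankEq (A : E →ₗ[ℝ] E') hinj hdim).toContinuousLinearEquiv
  have hA' : HasFDerivAt F (A' : E →L[ℝ] E') (extChartAt 𝓘(ℝ, E) x x) :=
    hA.congr_fderiv (by ext; rfl)
  let G := hFx.toOpenPartialHomeomorph F hA' one_ne_zero
  let c := chartAt E x
  let c' := chartAt E' (f x)
  have hG : ∀ p ∈ c.source, G (c p) = c' (f p) := fun p hp ↦ by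
    have h1 : G (c p) = c' (f (c.symm (c p))) := rfl
    rw [h1, c.left_inv hp]
  have hxc : x ∈ c.source := mem_chart_source E x
  have hxc' : f x ∈ c'.source := mem_chart_source E' (f x)
  have hxG : c x ∈ G.source := hFx.mem_toOpenPartialHomeomorph_source hA' one_ne_zero
  let U : Set M := f ⁻¹' c'.source
  have hU : IsOpen U := c'.open_source.preimage hf.continuous
  let e := ((c.trans G).trans c'.symm).restrOpen U hU
  have he : ∀ p ∈ c.source, f p ∈ c'.source → c'.symm (G (c p)) = f p := fun p hp hp' ↦ by
    rw [hG p hp, c'.left_inv hp']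
  refine ⟨e, ?_, ?_, ?_⟩
  · simp only [e, OpenPartialHomeomorph.restrOpen_source, OpenPartialHomeomorph.trans_source,
      OpenPartialHomeomorph.symm_source, Set.mem_inter_iff, Set.mem_preimage,
      OpenPartialHomeomorph.coe_trans, Function.comp_apply]
    exact ⟨⟨⟨hxc, hxG⟩, by rw [hG x hxc]; exact c'.map_source hxc'⟩, hxc'⟩
  · intro p hp
    simp only [e, OpenPartialHomeomorph.restrOpen_source, OpenPartialHomeomorph.trans_source,
      OpenPartialHomeomorph.symm_source, Set.mem_inter_iff, Set.mem_preimage,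
      OpenPartialHomeomorph.coe_trans, Function.comp_apply] at hp
    exact (he p hp.1.1.1 hp.2).symm
  · have h1 : ContMDiffAt 𝓘(ℝ, E') 𝓘(ℝ, E') 1 c' (f x) := by
      simpa using contMDiffAt_extChartAt (I := 𝓘(ℝ, E')) (n := 1) (x := f x)
    have h2 : ContDiffAt ℝ 1 G.symm (c' (f x)) := by
      have : ContDiffAt ℝ 1 G.symm (F (extChartAt 𝓘(ℝ, E) x x)) :=
        hFx.to_localInverse hA' one_ne_zero
      rwa [show F (extChartAt 𝓘(ℝ, E) x x) = c' (f x) from hG x hxc] at this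
    have h2x : G.symm (c' (f x)) = c x := by
      rw [← hG x hxc]; exact G.left_inv hxG
    have h3 : ContMDiffAt 𝓘(ℝ, E) 𝓘(ℝ, E) 1 c.symm (c x) := by
      have := (contMDiffOn_extChartAt_symm (I := 𝓘(ℝ, E)) (n := 1) x).contMDiffAt
        (extChartAt_target_mem_nhds x)
      simpa using this
    have h4 : ContMDiffAt 𝓘(ℝ, E') 𝓘(ℝ, E) 1 (fun y ↦ c.symm (G.symm (c' y))) (f x) :=
      ContMDiffAt.comp (f x) (g := c.symm) (f := fun y ↦ G.symm (c' y)) (by rwa [h2x])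
        (h2.contMDiffAt.comp (f x) h1)
    exact h4

end LocalInverse

section Sections

open Manifold Topology

variable {E : Type*} [NormedAddCommGroup E] [NormedSpace ℝ E] [FiniteDimensional ℝ E]
  {M : Type*} [MetricSpace M] [ChartedSpace E M] [IsManifold 𝓘(ℝ, E) 1 M]
  [RiemannianBundle (fun x : M ↦ TangentSpace 𝓘(ℝ, E) x)]
  {E' : Type*} [NormedAddCommGroup E'] [NormedSpace ℝ E'] [FiniteDimensional ℝ E']
  {M' : Type*} [MetricSpace M'] [ChartedSpace E' M'] [IsManifold 𝓘(ℝ, E') 1 M']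
  [RiemannianBundle (fun x : M' ↦ TangentSpace 𝓘(ℝ, E') x)]

/-- A continuous local section of a `C^1` map is `C^1` where the derivative is invertible, and it
contracts by the factor by which the map expands. -/
lemma contMDiffAt_section {g : M → M'} (hg : ContMDiff 𝓘(ℝ, E) 𝓘(ℝ, E') 1 g) {μ : NNReal}
    (hexp : ∀ (x : M) (v : TangentSpace 𝓘(ℝ, E) x),
      ‖v‖ ≤ μ * ‖mfderiv 𝓘(ℝ, E) 𝓘(ℝ, E') g x v‖)
    {φ : M' → M} {y : M'} (hdim : Module.finrank ℝ E = Module.finrank ℝ E')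
    (hφ : ContinuousAt φ y) (h : ∀ᶠ z in 𝓝 y, g (φ z) = z) :
    ContMDiffAt 𝓘(ℝ, E') 𝓘(ℝ, E) 1 φ y ∧
      ∀ w : TangentSpace 𝓘(ℝ, E') y, ‖mfderiv 𝓘(ℝ, E') 𝓘(ℝ, E) φ y w‖ₑ ≤ μ * ‖w‖ₑ := by
  have hy : g (φ y) = y := h.self_of_nhds
  have hinj : Function.Injective (mfderiv 𝓘(ℝ, E) 𝓘(ℝ, E') g (φ y)) := by
    refine (injective_iff_map_eq_zero _).2 fun v hv ↦ ?_
    have := hexp (φ y) v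
    rw [hv, norm_zero, mul_zero] at this
    exact norm_le_zero_iff.1 this
  obtain ⟨e, hes, he, hec⟩ :=
    exists_openPartialHomeomorph_of_injective_mfderiv hg (φ y) hinj hdim
  rw [hy] at hec
  have heq : e.symm =ᶠ[𝓝 y] φ := by
    filter_upwards [h, hφ.eventually (e.open_source.mem_nhds hes)] with z hz hze
    rw [← hz, he hze, e.left_inv hze, ← he hze, hz]
  have hφc : ContMDiffAt 𝓘(ℝ, E') 𝓘(ℝ, E) 1 φ y := hec.congr_of_eventuallyEq heq.symm
  refine ⟨hφc, fun w ↦ ?_⟩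
  have hcomp : (mfderiv 𝓘(ℝ, E) 𝓘(ℝ, E') g (φ y)).comp (mfderiv 𝓘(ℝ, E') 𝓘(ℝ, E) φ y) =
      ContinuousLinearMap.id ℝ E' := by
    have h1 := mfderiv_comp y (hg.mdifferentiable one_ne_zero (φ y))
      (hφc.mdifferentiableAt one_ne_zero)
    have h2 : g ∘ φ =ᶠ[𝓝 y] id := h
    rw [h2.mfderiv_eq, mfderiv_id] at h1
    exact h1.symm
  have hw : ‖mfderiv 𝓘(ℝ, E) 𝓘(ℝ, E') g (φ y) (mfderiv 𝓘(ℝ, E') 𝓘(ℝ, E) φ y w)‖ = ‖w‖ := by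
    have h3 : mfderiv 𝓘(ℝ, E) 𝓘(ℝ, E') g (φ y) (mfderiv 𝓘(ℝ, E') 𝓘(ℝ, E) φ y w) = (w : E') :=
      congrArg (fun A : E' →L[ℝ] E' ↦ A w) hcomp
    have hnorm : ∀ {p q : M'}, p = q → ∀ (u : TangentSpace 𝓘(ℝ, E') p)
        (w : TangentSpace 𝓘(ℝ, E') q), @Eq E' u w → ‖u‖ = ‖w‖ := by
      rintro p _ rfl u w huw
      exact congrArg (fun u : TangentSpace 𝓘(ℝ, E') p ↦ ‖u‖) huw
    exact hnorm hy _ _ h3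
  have h4 := hexp (φ y) (mfderiv 𝓘(ℝ, E') 𝓘(ℝ, E) φ y w)
  rw [hw] at h4
  simp only [enorm]
  exact_mod_cast h4

/-- A continuous section over a ball of a map which expands norms is Lipschitz on the ball with the
same centre and a third of the radius: paths of almost minimal length between points of the latter
stay in the former. -/
lemma dist_section_le [IsRiemannianManifold 𝓘(ℝ, E) M] [IsRiemannianManifold 𝓘(ℝ, E') M']
    {g : M → M'} (hg : ContMDiff 𝓘(ℝ, E) 𝓘(ℝ, E') 1 g) {μ : NNReal}
    (hexp : ∀ (x : M) (v : TangentSpace 𝓘(ℝ, E) x),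
      ‖v‖ ≤ μ * ‖mfderiv 𝓘(ℝ, E) 𝓘(ℝ, E') g x v‖)
    (hdim : Module.finrank ℝ E = Module.finrank ℝ E') {φ : M' → M} {x : M'} {r : ℝ}
    (hφ : ContinuousOn φ (Metric.ball x r)) (h : ∀ z ∈ Metric.ball x r, g (φ z) = z)
    {y z : M'} (hy : y ∈ Metric.ball x (r / 3)) (hz : z ∈ Metric.ball x (r / 3)) :
    dist (φ y) (φ z) ≤ μ * dist y z := by
  have hsub : Metric.eball y (ENNReal.ofReal (2 * r / 3)) ⊆ Metric.ball x r := by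
    intro p hp
    rw [Metric.eball_ofReal, Metric.mem_ball] at hp
    rw [Metric.mem_ball] at hy ⊢
    linarith [dist_triangle p y x]
  have hsec : ∀ p ∈ Metric.eball y (ENNReal.ofReal (2 * r / 3)), _ := fun p hp ↦
    contMDiffAt_section hg hexp hdim
      (hφ.continuousAt (Metric.isOpen_ball.mem_nhds (hsub hp)))
      (Filter.eventually_of_mem (Metric.isOpen_ball.mem_nhds (hsub hp)) h)
  have hyz : edist y z < ENNReal.ofReal (2 * r / 3) := by
    rw [edist_dist]
    have hd : dist y z < 2 * r / 3 := by
      rw [Metric.mem_ball] at hy hz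
      linarith [dist_triangle_right y z x]
    exact (ENNReal.ofReal_lt_ofReal_iff (dist_nonneg.trans_lt hd)).2 hd
  have := edist_le_of_mfderiv_le (E := E') (E' := E) (h := φ) hyz
    (fun p hp ↦ (hsec p hp).1.contMDiffWithinAt) fun p hp w ↦ (hsec p hp).2 w
  rw [edist_dist, edist_dist, ← ENNReal.ofReal_coe_nnreal,
    ← ENNReal.ofReal_mul μ.coe_nonneg] at this
  exact (ENNReal.ofReal_le_ofReal_iff (by positivity)).1 this

end Sections

/-! ### Inverse branches of a perturbation, at a uniform scale -/

section Lifting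

/-- Maps from a convex open set lift through covering maps. -/
lemma exists_lift_of_convex {A : Type*} [NormedAddCommGroup A] [NormedSpace ℝ A] {C : Set A}
    (hC : Convex ℝ C) (hCo : IsOpen C) {M M' : Type*} [TopologicalSpace M] [TopologicalSpace M']
    {g : M → M'} (hg : IsCoveringMap g) {P : A → M'} (hP : ContinuousOn P C) {a : A} (ha : a ∈ C)
    {x : M} (hx : g x = P a) :
    ∃ s : A → M, ContinuousOn s C ∧ s a = x ∧ ∀ c ∈ C, g (s c) = P c := by
  have : ContractibleSpace C := hC.contractibleSpace ⟨a, ha⟩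
  have : LocallyPathConnectedSpace C := hCo.locallyPathConnectedSpace
  obtain ⟨s, ⟨hs1, hs2⟩, -⟩ := hg.existsUnique_continuousMap_lifts
    ⟨C.domRestrict P, hP.domRestrict⟩ ⟨a, ha⟩ x hx
  classical
  refine ⟨fun c ↦ if h : c ∈ C then s ⟨c, h⟩ else x, ?_, ?_, ?_⟩
  · rw [continuousOn_iff_continuous_domRestrict]
    refine s.continuous.congr fun c ↦ ?_
    simp
  · simpa [ha] using hs1
  · intro c hc
    refine (congrArg g (dif_pos hc)).trans ?_
    exact congrFun hs2 ⟨c, hc⟩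

/-- At some uniform scale, the balls of a compact manifold factor through convex open sets of the
model space. -/
lemma exists_scale_factor_convex (A : Type*) [NormedAddCommGroup A] [NormedSpace ℝ A] {M : Type*}
    [MetricSpace M] [CompactSpace M] [ChartedSpace A M] :
    ∃ s > 0, ∀ u : M, ∃ (C : Set A) (q : M → A) (p : A → M), Convex ℝ C ∧ IsOpen C ∧
      ContinuousOn p C ∧ ContinuousOn q (Metric.ball u s) ∧ Set.MapsTo q (Metric.ball u s) C ∧
      ∀ y ∈ Metric.ball u s, p (q y) = y := by
  have h : ∀ x : M, ∃ ρ > 0, Metric.ball (chartAt A x x) ρ ⊆ (chartAt A x).target := fun x ↦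
    Metric.mem_nhds_iff.1 (chart_target_mem_nhds A x)
  choose ρ hρ hsub using h
  let U : M → Set M := fun x ↦
    (chartAt A x).source ∩ chartAt A x ⁻¹' Metric.ball (chartAt A x x) (ρ x)
  have hU : ∀ x, IsOpen (U x) := fun x ↦
    (chartAt A x).continuousOn.isOpen_inter_preimage (chartAt A x).open_source Metric.isOpen_ball
  obtain ⟨s, hs, h⟩ := lebesgue_number_lemma_of_metric (isCompact_univ (X := M)) hU
    fun x _ ↦ Set.mem_iUnion.2 ⟨x, mem_chart_source A x, Metric.mem_ball_self (hρ x)⟩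
  refine ⟨s, hs, fun u ↦ ?_⟩
  obtain ⟨x, hx⟩ := h u (Set.mem_univ u)
  exact ⟨Metric.ball (chartAt A x x) (ρ x), chartAt A x, (chartAt A x).symm, convex_ball _ _,
    Metric.isOpen_ball, (chartAt A x).continuousOn_symm.mono (hsub x),
    (chartAt A x).continuousOn.mono fun y hy ↦ (hx hy).1, fun y hy ↦ (hx hy).2,
    fun y hy ↦ (chartAt A x).left_inv (hx hy).1⟩

variable {X : ℕ → Type*} {f : (n : ℕ) → X n → X (n + 1)}

lemma surjective_orbitMap (hf : ∀ n, Function.Surjective (f n)) (n : ℕ) :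
    Function.Surjective (orbitMap f n) := by
  induction n with
  | zero => exact Function.surjective_id
  | succ n ih => exact (hf n).comp ih

variable [∀ n, MetricSpace (X n)]

lemma continuous_orbitMap (hf : ∀ n, Continuous (f n)) (n : ℕ) : Continuous (orbitMap f n) := by
  induction n with
  | zero => exact continuous_id
  | succ n ih => exact (hf n).comp ih

/-- The inverse branches of `f` compose to sections of `F_n` over balls of a fixed radius, which do
not expand the distance to the centre. -/
lemma InverseBranches.exists_section_orbitMap {r μ : ℝ} (B : InverseBranches f r μ) (hμ1 : μ ≤ 1)
    (n : ℕ) (u : X 0) :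
    ∃ Φ : X n → X 0, ContinuousOn Φ (Metric.ball (orbitMap f n u) r) ∧ Φ (orbitMap f n u) = u ∧
      ∀ y ∈ Metric.ball (orbitMap f n u) r, orbitMap f n (Φ y) = y ∧
        dist (Φ y) u ≤ dist y (orbitMap f n u) := by
  induction n with
  | zero => exact ⟨id, continuousOn_id, rfl, fun y _ ↦ ⟨rfl, le_rfl⟩⟩
  | succ n ih =>
    obtain ⟨Φ, hΦc, hΦu, hΦ⟩ := ih
    set x := orbitMap f n u
    have hx : orbitMap f (n + 1) u = f n x := rfl
    have hd : ∀ y ∈ Metric.ball (f n x) r, dist (B.branch n x y) x ≤ dist y (f n x) :=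
      fun y hy ↦ (B.dist_branch_self_le hy).trans (mul_le_of_le_one_left dist_nonneg hμ1)
    have hmaps : Set.MapsTo (B.branch n x) (Metric.ball (f n x) r) (Metric.ball x r) :=
      fun y hy ↦ (hd y hy).trans_lt hy
    rw [hx]
    refine ⟨Φ ∘ B.branch n x, hΦc.comp (B.continuousOn_branch n x) hmaps, ?_, fun y hy ↦ ⟨?_, ?_⟩⟩
    · rw [Function.comp_apply, B.branch_self, hΦu]
    · change f n (orbitMap f n (Φ (B.branch n x y))) = y
      rw [(hΦ _ (hmaps hy)).1, B.map_branch n x y hy]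
    · exact ((hΦ _ (hmaps hy)).2).trans (hd y hy)

/-- There is a scale depending on `f` only at which all covering maps `X n → X (n + 1)` have
sections over balls. Indeed, a ball in `X (n + 1)` is carried into a convex chart domain of the
compact manifold `X 0` by a section of `F_{n+1}`, and `F_{n+1}` lifts over this domain through any
covering map. -/
lemma InverseBranches.exists_scale_section (A : Type*) [NormedAddCommGroup A] [NormedSpace ℝ A]
    [CompactSpace (X 0)] [ChartedSpace A (X 0)] {δ μ : ℝ} (B : InverseBranches f δ μ)
    (hδ : 0 < δ) (hμ1 : μ ≤ 1) (hsurj : ∀ n, Function.Surjective (f n)) :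
    ∃ r > 0, r ≤ δ ∧ ∀ (n : ℕ) (g : X n → X (n + 1)), IsCoveringMap g → ∀ x : X n,
      ∃ φ : X (n + 1) → X n, ContinuousOn φ (Metric.ball (g x) r) ∧ φ (g x) = x ∧
        ∀ y ∈ Metric.ball (g x) r, g (φ y) = y := by
  obtain ⟨s, hs, hscale⟩ := exists_scale_factor_convex A (M := X 0)
  refine ⟨min s δ, lt_min hs hδ, min_le_right _ _, fun n g hg x ↦ ?_⟩
  obtain ⟨u, hu⟩ := surjective_orbitMap hsurj (n + 1) (g x)
  obtain ⟨Φ, hΦc, hΦu, hΦ⟩ := B.exists_section_orbitMap hμ1 (n + 1) u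
  obtain ⟨C, q, p, hC, hCo, hp, hq, hqC, hpq⟩ := hscale u
  rw [hu] at hΦc hΦu hΦ
  have hus : u ∈ Metric.ball u s := Metric.mem_ball_self hs
  obtain ⟨σ, hσc, hσ, hgσ⟩ := exists_lift_of_convex hC hCo hg (P := orbitMap f (n + 1) ∘ p)
    ((continuous_orbitMap B.continuous (n + 1)).comp_continuousOn hp) (hqC hus) (x := x)
    (by rw [Function.comp_apply, hpq u hus, hu])
  have hball : ∀ y ∈ Metric.ball (g x) (min s δ), y ∈ Metric.ball (g x) δ :=
    fun y hy ↦ Metric.ball_subset_ball (min_le_right _ _) hy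
  have hmaps : Set.MapsTo Φ (Metric.ball (g x) (min s δ)) (Metric.ball u s) := fun y hy ↦
    ((hΦ y (hball y hy)).2).trans_lt (lt_of_lt_of_le hy (min_le_left _ _))
  refine ⟨σ ∘ q ∘ Φ, hσc.comp (hq.comp (hΦc.mono hball) hmaps) (hqC.comp hmaps), ?_,
    fun y hy ↦ ?_⟩
  · simp only [Function.comp_apply, hΦu, hσ]
  · simp only [Function.comp_apply]
    rw [hgσ _ (hqC (hmaps hy)), Function.comp_apply, hpq _ (hmaps hy), (hΦ y (hball y hy)).1]

end Lifting

/-! ### Consequences of `C^1` closeness -/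

section C1

open Manifold Topology

variable {E : Type*} [NormedAddCommGroup E] [NormedSpace ℝ E]
  {M : Type*} [MetricSpace M] [ChartedSpace E M]
  [RiemannianBundle (fun x : M ↦ TangentSpace 𝓘(ℝ, E) x)]
  {E' : Type*} [NormedAddCommGroup E'] [NormedSpace ℝ E'] [FiniteDimensional ℝ E']
  {M' : Type*} [MetricSpace M'] [ChartedSpace E' M'] [IsManifold 𝓘(ℝ, E') ∞ M']
  [RiemannianBundle (fun x : M' ↦ TangentSpace 𝓘(ℝ, E') x)]

lemma edist_le_c1EDist [IsRiemannianManifold 𝓘(ℝ, E') M'] (f g : M → M') (x : M) :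
    edist (f x) (g x) ≤ c1EDist (E := E) (E' := E') f g := by
  refine le_iSup_of_le x (le_iInf fun γ ↦ le_iInf fun P ↦ le_iInf fun h ↦ ?_)
  rw [IsRiemannianManifold.out (I := 𝓘(ℝ, E')) (f x)]
  exact (riemannianEDist_le_pathELength h.2.2.1 h.1 h.2.1 zero_le_one).trans le_self_add

/-- Parallel transport being isometric, maps which are `C^1`-close have derivatives of nearly
the same norm. -/
lemma norm_mfderiv_le_of_c1EDist_lt {f g : M → M'} {ε : ℝ} (hε : 0 < ε)
    (h : c1EDist (E := E) (E' := E') f g < ENNReal.ofReal ε) (x : M)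
    (v : TangentSpace 𝓘(ℝ, E) x) :
    ‖mfderiv 𝓘(ℝ, E) 𝓘(ℝ, E') f x v‖ ≤ ‖mfderiv 𝓘(ℝ, E) 𝓘(ℝ, E') g x v‖ + ε * ‖v‖ := by
  have hx := (le_iSup _ x).trans_lt h
  simp only [iInf_lt_iff] at hx
  obtain ⟨γ, P, -, hP⟩ := hx
  have hunit : ∀ u : TangentSpace 𝓘(ℝ, E) x, ‖u‖ ≤ 1 →
      ‖P (mfderiv 𝓘(ℝ, E) 𝓘(ℝ, E') f x u) - mfderiv 𝓘(ℝ, E) 𝓘(ℝ, E') g x u‖ ≤ ε := by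
    intro u hu
    have h1 := ((le_iSup₂ (f := fun (v : TangentSpace 𝓘(ℝ, E) x) (_ : ‖v‖ ≤ 1) ↦
      ‖P (mfderiv 𝓘(ℝ, E) 𝓘(ℝ, E') f x v) - mfderiv 𝓘(ℝ, E) 𝓘(ℝ, E') g x v‖ₑ) u hu).trans
        le_add_self).trans_lt hP
    rw [← ofReal_norm] at h1
    exact ((ENNReal.ofReal_lt_ofReal_iff hε).1 h1).le
  rcases eq_or_ne v 0 with rfl | hv
  · simp
  have hv0 : 0 < ‖v‖ := norm_pos_iff.2 hv
  have h2 := hunit (‖v‖⁻¹ • v) (by rw [norm_smul, norm_inv, norm_norm, inv_mul_cancel₀ hv0.ne'])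
  rw [map_smul, map_smul, map_smul, ← smul_sub, norm_smul, norm_inv, norm_norm,
    inv_mul_le_iff₀ hv0] at h2
  have h3 := norm_sub_norm_le (P (mfderiv 𝓘(ℝ, E) 𝓘(ℝ, E') f x v))
    (mfderiv 𝓘(ℝ, E) 𝓘(ℝ, E') g x v)
  rw [P.norm_map] at h3
  linarith

lemma isContinuousRiemannianBundle_of_contMDiff [IsManifold 𝓘(ℝ, E) ∞ M]
    [IsContMDiffRiemannianBundle 𝓘(ℝ, E) ∞ E (fun x : M ↦ TangentSpace 𝓘(ℝ, E) x)] :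
    IsContinuousRiemannianBundle E (fun x : M ↦ TangentSpace 𝓘(ℝ, E) x) := by
  obtain ⟨g, hg, hg'⟩ := IsContMDiffRiemannianBundle.exists_contMDiff (IB := 𝓘(ℝ, E)) (n := ∞)
    (F := E) (E := fun x : M ↦ TangentSpace 𝓘(ℝ, E) x)
  exact ⟨g, hg.continuous, hg'⟩

end C1

section Sequence

open Manifold Topology

variable {E : ℕ → Type*} [∀ n, NormedAddCommGroup (E n)] [∀ n, NormedSpace ℝ (E n)]
  {X : ℕ → Type*} [∀ n, MetricSpace (X n)]
  [∀ n, ChartedSpace (E n) (X n)] [∀ n, IsManifold 𝓘(ℝ, E n) ∞ (X n)]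
  [∀ n, RiemannianBundle (fun x : X n ↦ TangentSpace 𝓘(ℝ, E n) x)]
  [∀ n, IsContMDiffRiemannianBundle 𝓘(ℝ, E n) ∞ (E n)
    (fun x : X n ↦ TangentSpace 𝓘(ℝ, E n) x)]
  [∀ n, IsRiemannianManifold 𝓘(ℝ, E n) (X n)]
  {f g : (n : ℕ) → X n → X (n + 1)}

lemma InverseBranches.norm_le_mul_norm_mfderiv {δ : ℝ} {μ : NNReal} (B : InverseBranches f δ μ)
    (hδ : 0 < δ) (hf : ∀ n, ContMDiff 𝓘(ℝ, E n) 𝓘(ℝ, E (n + 1)) 1 (f n)) (n : ℕ) (x : X n)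
    (v : TangentSpace 𝓘(ℝ, E n) x) :
    ‖v‖ ≤ μ * ‖mfderiv 𝓘(ℝ, E n) 𝓘(ℝ, E (n + 1)) (f n) x v‖ := by
  have h1 := isContinuousRiemannianBundle_of_contMDiff (E := E n) (M := X n)
  have h2 := isContinuousRiemannianBundle_of_contMDiff (E := E (n + 1)) (M := X (n + 1))
  refine SeqDyn.norm_le_mul_norm_mfderiv (hf n x) ?_ v
  filter_upwards [B.eventually_branch_self hδ x,
    (B.continuous n).continuousAt.eventually (Metric.ball_mem_nhds (f n x) hδ)] with y hy hyb
  have h := B.dist_branch_self_le hyb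
  rw [hy, dist_comm, dist_comm (f n y)] at h
  rw [edist_dist, edist_dist, ← ENNReal.ofReal_coe_nnreal, ← ENNReal.ofReal_mul μ.coe_nonneg]
  exact ENNReal.ofReal_le_ofReal h

variable [∀ n, FiniteDimensional ℝ (E n)]

lemma InverseBranches.finrank_eq {δ : ℝ} {μ : NNReal} (B : InverseBranches f δ μ)
    (hδ : 0 < δ) (hf : ∀ n, ContMDiff 𝓘(ℝ, E n) 𝓘(ℝ, E (n + 1)) 1 (f n)) (n : ℕ) (x : X n) :
    Module.finrank ℝ (E n) = Module.finrank ℝ (E (n + 1)) := by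
  refine le_antisymm ?_ ?_
  · let A : E n →L[ℝ] E (n + 1) := mfderiv 𝓘(ℝ, E n) 𝓘(ℝ, E (n + 1)) (f n) x
    have hinj : Function.Injective (mfderiv 𝓘(ℝ, E n) 𝓘(ℝ, E (n + 1)) (f n) x) := by
      refine (injective_iff_map_eq_zero _).2 fun v hv ↦ ?_
      have := B.norm_le_mul_norm_mfderiv hδ hf n x v
      rw [hv, norm_zero, mul_zero] at this
      exact norm_le_zero_iff.1 this
    exact LinearMap.finrank_le_finrank_of_injective (f := (A : E n →ₗ[ℝ] E (n + 1))) hinj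
  · have hb : Metric.ball (f n x) δ ∈ 𝓝 (f n x) := Metric.ball_mem_nhds _ hδ
    exact finrank_le_of_section (hf n x) ((B.continuousOn_branch n x).continuousAt hb)
      (B.branch_self n x) (Filter.eventually_of_mem hb (B.map_branch n x))

/-- There is a scale, depending on `f` only, at which all sequences of `C^1` maps which expand
norms have inverse branches. -/
lemma InverseBranches.exists_scale_branches [∀ n, CompactSpace (X n)] {δ : ℝ}
    {μ : NNReal} (B : InverseBranches f δ μ) (hδ : 0 < δ) (hμ1 : μ ≤ 1)
    (hf : ∀ n, ContMDiff 𝓘(ℝ, E n) 𝓘(ℝ, E (n + 1)) 1 (f n))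
    (hsurj : ∀ n, Function.Surjective (f n)) :
    ∃ r > 0, r ≤ δ ∧ ∀ (g : (n : ℕ) → X n → X (n + 1)) (ν : NNReal),
      (∀ n, ContMDiff 𝓘(ℝ, E n) 𝓘(ℝ, E (n + 1)) 1 (g n)) →
      (∀ (n : ℕ) (x : X n) (v : TangentSpace 𝓘(ℝ, E n) x),
        ‖v‖ ≤ ν * ‖mfderiv 𝓘(ℝ, E n) 𝓘(ℝ, E (n + 1)) (g n) x v‖) →
      Nonempty (InverseBranches g r ν) := by
  obtain ⟨r, hr, hrδ, hsec⟩ := B.exists_scale_section (E 0) hδ (mod_cast hμ1) hsurj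
  refine ⟨r / 3, by positivity, by linarith, fun g ν hg hexp ↦ ?_⟩
  have hloc : ∀ n, IsLocalHomeomorph (g n) := fun n ↦ by
    refine IsLocalHomeomorph.mk _ fun x ↦ ?_
    obtain ⟨e, hxe, he, -⟩ := exists_openPartialHomeomorph_of_injective_mfderiv (hg n) x
      ((injective_iff_map_eq_zero _).2 fun v hv ↦ by
        have := hexp n x v
        rw [hv, norm_zero, mul_zero] at this
        exact norm_le_zero_iff.1 this) (B.finrank_eq hδ hf n x)
    exact ⟨e, hxe, he⟩
  choose φ hφc hφx hφ using fun n ↦ hsec n (g n) (isLocalHomeomorph_iff_isCoveringMap.1 (hloc n))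
  exact ⟨{
    continuous := fun n ↦ (hg n).continuous
    locallyInjective := fun n ↦ (hloc n).isLocallyInjective
    branch := φ
    branch_self := hφx
    map_branch := fun n x y hy ↦ hφ n x y (Metric.ball_subset_ball (by linarith) hy)
    dist_branch_le := fun n x y hy z hz ↦
      dist_section_le (hg n) (hexp n) (B.finrank_eq hδ hf n x) (hφc n x) (hφ n x) hy hz }⟩

end Sequence

lemma semiconj_symm {X : ℕ → Type*} [∀ n, TopologicalSpace (X n)]
    {f g : (n : ℕ) → X n → X (n + 1)} {H : (n : ℕ) → X n ≃ₜ X n}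
    (hH : ∀ n x, f n (H n x) = H (n + 1) (g n x)) (n : ℕ) (x : X n) :
    g n ((H n).symm x) = (H (n + 1)).symm (f n x) := by
  refine (H (n + 1)).injective ?_
  rw [← hH, (H n).apply_symm_apply, (H (n + 1)).apply_symm_apply]

/-- A sequence of homeomorphisms which intertwines the maps provides conjugating homeomorphisms for
all pairs of shifted sequences, in both directions. -/
lemma isConjugatingHomeo_shift {X : ℕ → Type*} [∀ n, MetricSpace (X n)]
    {f g : (n : ℕ) → X n → X (n + 1)} {H : (n : ℕ) → X n ≃ₜ X n} {η : ℝ}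
    (hH : ∀ n x, f n (H n x) = H (n + 1) (g n x)) (hη : ∀ n x, dist (H n x) x ≤ η) (m : ℕ) :
    IsConjugatingHomeo (X := fun k ↦ X (m + k)) η (shift f m) (shift g m) (H m) ∧
      IsConjugatingHomeo (X := fun k ↦ X (m + k)) η (shift g m) (shift f m) (H m).symm := by
  refine ⟨⟨fun k ↦ H (m + k), rfl, fun k ↦ ?_, fun k x ↦ hη (m + k) x⟩,
    ⟨fun k ↦ (H (m + k)).symm, rfl, fun k ↦ ?_, fun k x ↦ ?_⟩⟩
  · exact comp_orbitMap (X := fun k ↦ X (m + k)) (f := shift f m) (g := shift g m)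
      (H := fun k ↦ H (m + k)) (fun k x ↦ hH (m + k) x) k
  · exact comp_orbitMap (X := fun k ↦ X (m + k)) (f := shift g m) (g := shift f m)
      (H := fun k ↦ (H (m + k)).symm) (fun k x ↦ semiconj_symm hH (m + k) x) k
  · have := hη (m + k) ((H (m + k)).symm x)
    rwa [(H (m + k)).apply_symm_apply, dist_comm] at this

end SeqDyn

end

/-! ### Conjugacy of nearby sequences -/

theorem mainTheorem5
    {E : ℕ → Type*} [∀ n, NormedAddCommGroup (E n)] [∀ n, NormedSpace ℝ (E n)]
    [∀ n, FiniteDimensional ℝ (E n)]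
    {X : ℕ → Type*} [∀ n, MetricSpace (X n)] [∀ n, CompactSpace (X n)]
    [∀ n, ChartedSpace (E n) (X n)] [∀ n, IsManifold 𝓘(ℝ, E n) ∞ (X n)]
    [∀ n, RiemannianBundle (fun x : X n ↦ TangentSpace 𝓘(ℝ, E n) x)]
    [∀ n, IsContMDiffRiemannianBundle 𝓘(ℝ, E n) ∞ (E n)
      (fun x : X n ↦ TangentSpace 𝓘(ℝ, E n) x)]
    [∀ n, IsRiemannianManifold 𝓘(ℝ, E n) (X n)]
    (f : (n : ℕ) → X n → X (n + 1))
    (hf : ∀ n, ContMDiff 𝓘(ℝ, E n) 𝓘(ℝ, E (n + 1)) 1 (f n))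
    (lam : ℕ → ℝ) (hexp : SeqDyn.IsExpandingSeq f lam) (hlam : (⨆ n, lam n) < 1) :
    ∃ ε : ℝ, 0 < ε ∧ ∃ η : ℝ, 0 < η ∧ ∃ L : ℝ, 0 < L ∧
      ∀ g : (n : ℕ) → X n → X (n + 1),
        (∀ n, ContMDiff 𝓘(ℝ, E n) 𝓘(ℝ, E (n + 1)) 1 (g n)) →
        SeqDyn.seqC1EDist (E := E) f g < ENNReal.ofReal ε →
        -- `hFG n` and `hGF n` are the homeomorphisms of the shifted pairs of sequences
        ∃ hFG hGF : (n : ℕ) → X n ≃ₜ X n,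
          (∀ n, SeqDyn.IsConjugatingHomeo (X := fun k ↦ X (n + k)) η
            (SeqDyn.shift f n) (SeqDyn.shift g n) (hFG n)) ∧
          (∀ n, SeqDyn.IsConjugatingHomeo (X := fun k ↦ X (n + k)) η
            (SeqDyn.shift g n) (SeqDyn.shift f n) (hGF n)) ∧
          -- they are determined by these sequences
          (SeqDyn.IsUniformlyLocallyInjective f →
            (∀ (n : ℕ) (h : X n ≃ₜ X n),
              SeqDyn.IsConjugatingHomeo (X := fun k ↦ X (n + k)) η
                (SeqDyn.shift f n) (SeqDyn.shift g n) h → h = hFG n) ∧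
            (∀ (n : ℕ) (h : X n ≃ₜ X n),
              SeqDyn.IsConjugatingHomeo (X := fun k ↦ X (n + k)) η
                (SeqDyn.shift g n) (SeqDyn.shift f n) h → h = hGF n)) ∧
          (∀ n, hGF n = (hFG n).symm) ∧
          -- the conjugacy relation
          (∀ n, hGF n ∘ SeqDyn.orbitMap f n = SeqDyn.orbitMap g n ∘ hGF 0) ∧
          (∀ n, hFG n ∘ SeqDyn.orbitMap g n = SeqDyn.orbitMap f n ∘ hFG 0) ∧
          -- distance to the identity
          (∀ x : X 0, edist (hFG 0 x) x ≤ ENNReal.ofReal L * SeqDyn.seqC1EDist (E := E) g f) ∧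
          (∀ (n : ℕ) (x : X n), edist (hFG n x) x ≤ ENNReal.ofReal L *
            SeqDyn.seqC1EDist (E := fun k ↦ E (n + k)) (X := fun k ↦ X (n + k))
              (SeqDyn.shift g n) (SeqDyn.shift f n)) := by
  have hbdd : BddAbove (Set.range lam) := ⟨1, by
    rintro _ ⟨n, rfl⟩
    exact (hexp.2.2.1 n).2.le⟩
  have hlam_le : ∀ n, lam n ≤ ⨆ n, lam n := le_ciSup hbdd
  have hsurj := hexp.2.1
  obtain ⟨lam', hlam'⟩ : ∃ lam' : NNReal, (lam' : ℝ) = ⨆ n, lam n :=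
    ⟨⟨⨆ n, lam n, (hexp.2.2.1 0).1.le.trans (hlam_le 0)⟩, rfl⟩
  have hpos : 0 < (lam' : ℝ) := hlam' ▸ (hexp.2.2.1 0).1.trans_le (hlam_le 0)
  rw [← hlam'] at hlam
  obtain ⟨δ, hδ, ⟨B₀⟩⟩ := hexp.exists_inverseBranches (μ := lam') (by rwa [hlam'])
  obtain ⟨r, hr, hrδ, hbranches⟩ := B₀.exists_scale_branches hδ (mod_cast hlam.le) hf hsurj
  -- The inverse rate of a perturbation is the mean of `1` and the inverse rate of `f`.
  obtain ⟨μ, hμ⟩ : ∃ μ : NNReal, (μ : ℝ) = (((lam' : ℝ)⁻¹ + 1) / 2)⁻¹ :=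
    ⟨⟨(((lam' : ℝ)⁻¹ + 1) / 2)⁻¹, by positivity⟩, rfl⟩
  have hinv : 1 < (lam' : ℝ)⁻¹ := (one_lt_inv₀ hpos).2 hlam
  have hμ0 : 0 < (μ : ℝ) := by rw [hμ]; positivity
  have hμ1 : (μ : ℝ) < 1 := by rw [hμ]; exact inv_lt_one_of_one_lt₀ (by linarith)
  have hlamμ : (lam' : ℝ) ≤ μ := by
    rw [hμ, le_inv_comm₀ hpos (by positivity)]
    linarith
  have B := B₀.mono hrδ hlamμ
  have hball : ∀ (n : ℕ) (x : X n) (s : ℝ), IsPreconnected (Metric.ball x s) := fun n x s ↦ by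
    rw [← Metric.eball_ofReal]
    exact SeqDyn.isPreconnected_eball (E n) x _
  -- The scale at which `f` is injective, if there is one.
  obtain ⟨ρ, hρ, hρinj⟩ : ∃ ρ : ℝ, 0 < ρ ∧ (SeqDyn.IsUniformlyLocallyInjective f →
      ∀ (n : ℕ) (x y : X n), dist x y < ρ → f n x = f n y → x = y) := by
    by_cases h : SeqDyn.IsUniformlyLocallyInjective f
    · obtain ⟨ρ, hρ, h'⟩ := h
      exact ⟨ρ, hρ, fun _ ↦ h'⟩
    · exact ⟨1, one_pos, fun h' ↦ absurd h' h⟩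
  set L : ℝ := μ / (1 - μ) with hL
  have hL0 : 0 < L := div_pos hμ0 (by linarith)
  -- Expansivity of `f` is used at scale `4 * η`: this has to be less than `r` and than `ρ / 2`.
  set η : ℝ := min (r / 8) (ρ / 16) with hη
  have hη0 : 0 < η := lt_min (by positivity) (by positivity)
  have hηr : η ≤ r / 8 := min_le_left _ _
  have hηρ : η ≤ ρ / 16 := min_le_right _ _
  -- The first bound makes the derivative of a perturbation expanding with rate `μ⁻¹`, the second
  -- bounds the displacement `L * ε` of the conjugacy by `η`.
  set ε : ℝ := min (((lam' : ℝ)⁻¹ - 1) / 2) (η / (L + 1)) with hε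
  have hε0 : 0 < ε := lt_min (by linarith) (by positivity)
  have hεη : L * ε + ε ≤ η := by
    have : ε ≤ η / (L + 1) := min_le_right _ _
    rw [le_div_iff₀ (by positivity)] at this
    linarith
  refine ⟨ε, hε0, η, hη0, L, hL0, fun g hg hfg ↦ ?_⟩
  have hc1 : ∀ n, SeqDyn.c1EDist (E := E n) (E' := E (n + 1)) (f n) (g n) < ENNReal.ofReal ε :=
    fun n ↦ (le_iSup (fun n ↦ SeqDyn.c1EDist (E := E n) (E' := E (n + 1)) (f n) (g n)) n).trans_lt
      hfg
  have hdist : ∀ n x, dist (f n x) (g n x) ≤ ε := fun n x ↦ by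
    have h := (SeqDyn.edist_le_c1EDist (E := E n) (E' := E (n + 1)) (f n) (g n) x).trans_lt (hc1 n)
    rw [edist_dist] at h
    exact ((ENNReal.ofReal_lt_ofReal_iff hε0).1 h).le
  have hgexp : ∀ (n : ℕ) (x : X n) (v : TangentSpace 𝓘(ℝ, E n) x),
      ‖v‖ ≤ μ * ‖mfderiv 𝓘(ℝ, E n) 𝓘(ℝ, E (n + 1)) (g n) x v‖ := fun n x v ↦ by
    have h1 := B₀.norm_le_mul_norm_mfderiv hδ hf n x v
    have h2 := SeqDyn.norm_mfderiv_le_of_c1EDist_lt hε0 (hc1 n) x v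
    have h3 : ε * ‖v‖ ≤ ((lam' : ℝ)⁻¹ - 1) / 2 * ‖v‖ :=
      mul_le_mul_of_nonneg_right (min_le_left _ _) (norm_nonneg v)
    rw [← inv_mul_le_iff₀ hpos] at h1
    rw [hμ, ← div_eq_inv_mul, le_div_iff₀ (by positivity)]
    linarith
  obtain ⟨C⟩ := hbranches g μ hg hgexp
  obtain ⟨H, hH, hHd⟩ := B.exists_conjugacy hball C hμ0.le hμ1 hε0.le hdist (by linarith)
  have hHη : ∀ n x, dist (H n x) x ≤ η := fun n x ↦ by
    linarith [hHd n ε (fun n _ x ↦ hdist n x) x]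
  have hHedist : ∀ (N : ℕ) (S : ℝ≥0∞), (∀ n ≥ N, ∀ x, edist (f n x) (g n x) ≤ S) →
      ∀ x, edist (H N x) x ≤ ENNReal.ofReal L * S := by
    intro N S hS x
    rcases eq_or_ne S ⊤ with rfl | hSt
    · rw [ENNReal.mul_top (by simpa using hL0)]
      exact le_top
    · rw [← ENNReal.ofReal_toReal hSt, ← ENNReal.ofReal_mul hL0.le, edist_dist]
      refine ENNReal.ofReal_le_ofReal (hHd N S.toReal (fun n hn x ↦ ?_) x)
      rw [dist_edist]
      exact ENNReal.toReal_mono hSt (hS n hn x)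
  have hconj := fun n ↦ SeqDyn.isConjugatingHomeo_shift hH hHη n
  have hconj0 : SeqDyn.IsSequentialConjugacy f g fun n ↦ (H n).symm :=
    SeqDyn.comp_orbitMap (f := g) (g := f) (H := fun n ↦ (H n).symm) (SeqDyn.semiconj_symm hH)
  refine ⟨H, fun n ↦ (H n).symm, fun n ↦ (hconj n).1, fun n ↦ (hconj n).2, fun hinj ↦ ⟨?_, ?_⟩,
    fun n ↦ rfl, hconj0, SeqDyn.comp_orbitMap hH, ?_, ?_⟩
  · intro n h hh
    exact (B.shift n).isConjugatingHomeo_unique hμ0.le hμ1 (fun k ↦ hρinj hinj (n + k))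
      (by linarith) (by linarith) hη0.le hh (hconj n).1
  · intro n h hh
    exact (B.shift n).isConjugatingHomeo_unique' hμ0.le hμ1 (fun k ↦ hρinj hinj (n + k))
      (by linarith) (by linarith) (hconj n).1 hh (hconj n).2
  · refine hHedist 0 _ fun n _ x ↦ ?_
    rw [edist_comm]
    exact (SeqDyn.edist_le_c1EDist (E := E n) (E' := E (n + 1)) (g n) (f n) x).trans
      (le_iSup (fun n ↦ SeqDyn.c1EDist (E := E n) (E' := E (n + 1)) (g n) (f n)) n)
  · intro N
    refine hHedist N _ fun n hn x ↦ ?_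
    obtain ⟨k, rfl⟩ := Nat.exists_eq_add_of_le hn
    rw [edist_comm]
    exact (SeqDyn.edist_le_c1EDist (E := E (N + k)) (E' := E (N + k + 1)) (g (N + k)) (f (N + k))
      x).trans (le_iSup (fun k ↦ SeqDyn.c1EDist (E := E (N + k)) (E' := E (N + k + 1))
        (g (N + k)) (f (N + k))) k)
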